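/- Let $K$ be an abstract simplicial complex (nonempty finite simplices) in which every simplex is contained in a maximal simplex; this holds for instance if $K$ is finite. Complexes are identified with their geometric realizations, $\simeq$ denotes homotopy equivalence, and $S^n$ is the unit sphere in $\mathbb{R}^{n+1}$. For a vertex $v$ of $K$ let $\mathrm{st}_K(v)=\{s\neq\emptyset : s\cup\{v\}\in K\}$; for a subcomplex $L$ of $K$ let $\mathrm{SC}_K(L)=\bigcup_{v\in L^{(0)}}\mathrm{st}_K(v)$, where $L^{(0)}$ is the vertex set of $L$; and for a simplex $s$ let $K_s$ be the complex of all nonempty subsets of $s$. Let $L$ be a subcomplex of $K$ with $\mathrm{SC}_K(L)\simeq L$. Let $\{\sigma_1,\dots,\sigma_a,\tau_1,\dots,\tau_b\}$ ($a,b\ge 0$) be the collection of all maximal simplices of $K$ that contain no vertex of $L$. Suppose that there is an integer $d\ge 0$ such that 1. $K_{\sigma_i}\cap \mathrm{SC}_K(L)$ is contractible for $i=1,\dots,a$; 2. for $j=1,\dots,b$, $K_{\tau_j}\cap \mathrm{SC}_K(L)$ is homotopy equivalent to $S^d$ and its inclusion into $\mathrm{SC}_K(L)$ is null-homotopic (homotopic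 to a constant map); 3. $K_{\sigma_i}\cap K_{\sigma_j}$ for $i\ne j$, $K_{\tau_i}\cap K_{\tau_j}$ for $i\neq j$, and $K_{\sigma_k}\cap K_{\tau_\ell}$ for all $k,\ell$, are contained in $\mathrm{SC}_K(L)$. Then there are points $p_1,\dots,p_b$ of $L$ such that $K$ is homotopy equivalent to the space obtained from $L$ by gluing, for each $j=1,\dots,b$, a copy of $S^{d+1}$ to $L$ by identifying its base point with $p_j$. If moreover $L$ is connected (and nonempty), then for every point $x$ of $L$, $$K\simeq L\vee\bigvee_b S^{d+1},$$ where the wedge is formed at the point $x$ of $L$. -/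

import Mathlib

open ContinuousMap

namespace PreAbstractSimplicialComplex

variable {V : Type*}

/-- `s` is a facet (maximal simplex) of `K`. -/
def IsFacet (K : PreAbstractSimplicialComplex V) (s : Finset V) : Prop :=
  s ∈ K ∧ ∀ t ∈ K, s ⊆ t → s = t

/-- The vertex set `K⁽⁰⁾` of `K`. -/
def vertices (K : PreAbstractSimplicialComplex V) : Set V := {v | {v} ∈ K}

/-- The complex `K_s` generated by `s`: all nonempty subsets of `s`. -/
def simplexComplex (s : Finset V) : PreAbstractSimplicialComplex V where
  faces := {t | t.Nonempty ∧ t ⊆ s}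
  isRelLowerSet_faces := fun _ ht => ⟨ht.1, fun _ hut hu => ⟨hu, hut.trans ht.2⟩⟩

/-- The star `st_K(v)`: all simplices `s` with `s ∪ {v} ∈ K`. -/
def vertexStar [DecidableEq V] (K : PreAbstractSimplicialComplex V) (v : V) :
    PreAbstractSimplicialComplex V where
  faces := {s | s.Nonempty ∧ s ∪ {v} ∈ K}
  isRelLowerSet_faces := fun _ hs => ⟨hs.1, fun _ hts ht => ⟨ht,
    (K.isRelLowerSet_faces hs.2).2 (Finset.union_subset_union_left hts)
      (ht.mono Finset.subset_union_left)⟩⟩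

/-- The star cluster `SC_K(L)`: the union of the stars in `K` of the vertices of `L`. -/
def starCluster [DecidableEq V] (K L : PreAbstractSimplicialComplex V) :
    PreAbstractSimplicialComplex V where
  faces := ⋃ v ∈ L.vertices, (K.vertexStar v).faces
  isRelLowerSet_faces :=
    IsRelLowerSet.iUnion₂ fun v _ => (K.vertexStar v).isRelLowerSet_faces

/-- The points of the geometric realization `|K|`: barycentric coordinates whose support is a
simplex of `K`. -/
def Realization (K : PreAbstractSimplicialComplex V) : Type _ :=
  {x : V →₀ ℝ // (∀ v, 0 ≤ x v) ∧ x.sum (fun _ r => r) = 1 ∧ x.support ∈ K}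

namespace Realization

/-- The closed simplex of `|K|` spanned by `s`. -/
def ClosedSimplex (K : PreAbstractSimplicialComplex V) (s : Finset V) : Type _ :=
  {x : K.Realization // x.1.support ⊆ s}

/-- A closed simplex carries its Euclidean topology, given by the barycentric coordinates. -/
instance (K : PreAbstractSimplicialComplex V) (s : Finset V) :
    TopologicalSpace (ClosedSimplex K s) :=
  TopologicalSpace.induced (fun x (v : V) => x.1.1 v) inferInstance

/-- `|K|` carries the weak topology: a set is open if and only if its intersection with each
closed simplex is open in that simplex. -/
instance (K : PreAbstractSimplicialComplex V) : TopologicalSpace K.Realization :=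
  ⨆ s : {s : Finset V // s ∈ K},
    TopologicalSpace.coinduced (fun x : ClosedSimplex K s.1 => x.1) inferInstance

/-- The inclusion `|L| → |K|` of a subcomplex. -/
def inclusion {L K : PreAbstractSimplicialComplex V} (h : L ≤ K) :
    C(L.Realization, K.Realization) where
  toFun x := ⟨x.1, x.2.1, x.2.2.1, h x.2.2.2⟩
  continuous_toFun := by
    refine continuous_iSup_dom.2 fun s => continuous_coinduced_dom.2 ?_
    have h1 : Continuous (fun x : ClosedSimplex K s.1 => x.1) :=
      continuous_iff_coinduced_le.2
        (le_iSup (fun s : {s : Finset V // s ∈ K} =>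
          TopologicalSpace.coinduced (fun x : ClosedSimplex K s.1 => x.1) inferInstance)
          ⟨s.1, h s.2⟩)
    let g : ClosedSimplex L s.1 → ClosedSimplex K s.1 :=
      fun x => ⟨⟨x.1.1, x.1.2.1, x.1.2.2.1, h x.1.2.2.2⟩, x.2⟩
    have h2 : Continuous g :=
      continuous_induced_rng.2
        (continuous_induced_dom (f := fun (x : ClosedSimplex L s.1) (v : V) => x.1.1 v))
    exact h1.comp h2

end Realization

end PreAbstractSimplicialComplex

/-- The unit sphere `Sⁿ` in `ℝⁿ⁺¹`. -/
abbrev UnitSphere (n : ℕ) : Type := Metric.sphere (0 : EuclideanSpace ℝ (Fin (n + 1))) 1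

/-- The base point of `Sⁿ`. -/
noncomputable def UnitSphere.base (n : ℕ) : UnitSphere n :=
  ⟨EuclideanSpace.single 0 1, by simp⟩

/-- The identifications made in the disjoint union of `X` and `b` copies of `Sⁿ`: the base point
of the `i`-th sphere is glued to the point `p i` of `X`. -/
inductive SphereGluing {X : Type*} {b : ℕ} (n : ℕ) (p : Fin b → X) :
    X ⊕ (Fin b × UnitSphere n) → X ⊕ (Fin b × UnitSphere n) → Prop
  | glue (i : Fin b) : SphereGluing n p (Sum.inl (p i)) (Sum.inr (i, UnitSphere.base n))

/-- The space obtained from `X` by gluing, for each `i`, a copy of `Sⁿ` to the point `p i`. If `p`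
is constant with value `x`, this is the wedge `X ∨ ⋁_b Sⁿ` formed at the point `x`. -/
def WedgeSpheres {X : Type*} {b : ℕ} (n : ℕ) (p : Fin b → X) : Type _ :=
  Quot (SphereGluing n p)

instance {X : Type*} [TopologicalSpace X] {b : ℕ} (n : ℕ) (p : Fin b → X) :
    TopologicalSpace (WedgeSpheres n p) :=
  inferInstanceAs (TopologicalSpace (Quot (SphereGluing n p)))

section

open scoped unitInterval

/-! Write M for the star cluster of L. Every simplex of K lies in a facet. If that facet has a
vertex of L, the simplex lies in M; otherwise the facet is one of the σ_i, τ_j. So |K| is |M| with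
these simplices glued on along their intersections with M, and by condition 3 they meet one another
only inside M. Since a subcomplex of a simplex has the homotopy extension property
(`exists_homotopy_extension`), this pushout is equivalent to the double mapping cylinder of the
gluing diagram (`nonempty_homotopyEquiv_gluing`).

A double mapping cylinder depends on its diagram only up to homotopy
(`DoubleCylinder.isHEquiv_map`). A map out of it is a pair of maps on the ends together with a path
in a mapping space, so this invariance reduces to identities between homotopy classes of paths.
Hence M may be replaced by L, each intersection by a point or by S^d, each simplex by a point, and
each null-homotopic attaching map by a constant. The result is L with an arc attached for every σ_i,
which can be shrunk, and a suspension of S^d, that is S^{d+1}, attached at a point for every τ_j.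

If L is connected it is path connected, so all the constants can be moved to the prescribed point
before gluing. -/

/-- `φ` is a homotopy equivalence. -/
def IsHEquiv {X Y : Type*} [TopologicalSpace X] [TopologicalSpace Y] (φ : C(X, Y)) : Prop :=
  ∃ ψ : C(Y, X), (ψ.comp φ).Homotopic (ContinuousMap.id X) ∧
    (φ.comp ψ).Homotopic (ContinuousMap.id Y)

/-! ### Homotopy equivalences as a property of maps. -/

namespace IsHEquiv

variable {X Y Z : Type*} [TopologicalSpace X] [TopologicalSpace Y] [TopologicalSpace Z]

theorem nonempty {φ : C(X, Y)} (h : IsHEquiv φ) : Nonempty (X ≃ₕ Y) :=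
  let ⟨ψ, h1, h2⟩ := h
  ⟨⟨φ, ψ, h1, h2⟩⟩

theorem of_homotopyEquiv (e : X ≃ₕ Y) : IsHEquiv e.toFun :=
  ⟨e.invFun, e.left_inv, e.right_inv⟩

theorem congr {φ φ' : C(X, Y)} (h : IsHEquiv φ) (hh : φ.Homotopic φ') : IsHEquiv φ' := by
  obtain ⟨ψ, h1, h2⟩ := h
  exact ⟨ψ, ((Homotopic.refl ψ).comp hh.symm).trans h1, (hh.symm.comp (Homotopic.refl ψ)).trans h2⟩

/-- A map with a left and a right inverse up to homotopy equivalences is a homotopy equivalence. -/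
theorem of_comp {φ : C(X, Y)} {ψ : C(Y, X)} (h1 : IsHEquiv (ψ.comp φ))
    (h2 : IsHEquiv (φ.comp ψ)) : IsHEquiv φ := by
  obtain ⟨l, hl, -⟩ := h1
  obtain ⟨r, -, hr⟩ := h2
  -- A left inverse and a right inverse of `φ` agree up to homotopy: evaluate l ψ φ ψ r in two ways.
  have key : (l.comp ψ).Homotopic (ψ.comp r) := by
    have e1 : ((l.comp (ψ.comp φ)).comp (ψ.comp r)).Homotopic (ψ.comp r) :=
      hl.comp (Homotopic.refl (ψ.comp r))
    have e2 : ((l.comp ψ).comp ((φ.comp ψ).comp r)).Homotopic (l.comp ψ) :=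
      (Homotopic.refl (l.comp ψ)).comp hr
    exact e2.symm.trans e1
  exact ⟨l.comp ψ, hl, ((Homotopic.refl φ).comp key).trans hr⟩

end IsHEquiv

/-! ### Homotopies as paths in mapping spaces. -/

section Paths

variable {A B Y Z : Type*} [TopologicalSpace A] [TopologicalSpace B] [TopologicalSpace Y]
  [TopologicalSpace Z]

/-- The two boundary paths of a square are homotopic. -/
theorem Path.homotopic_of_square {a b c e : Y} (Q : C(I × I, Y)) (p : Path a b) (q : Path b e)
    (p' : Path a c) (q' : Path c e) (hp : ∀ t, p t = Q (t, 0)) (hq : ∀ t, q t = Q (1, t))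
    (hp' : ∀ t, p' t = Q (0, t)) (hq' : ∀ t, q' t = Q (t, 1)) :
    (p.trans q).Homotopic (p'.trans q') := by
  obtain rfl : a = Q (0, 0) := by rw [← hp 0, p.source]
  obtain rfl : b = Q (1, 0) := by rw [← hp 1, p.target]
  obtain rfl : c = Q (0, 1) := by rw [← hp' 1, p'.target]
  obtain rfl : e = Q (1, 1) := by rw [← hq 1, q.target]
  let i : Path (0 : I) 1 := ⟨ContinuousMap.id I, rfl, rfl⟩
  have e1 : p.trans q = ((i.prod (Path.refl 0)).trans ((Path.refl 1).prod i)).map Q.continuous := by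
    rw [Path.map_trans]; congr 1 <;> ext t <;> simp [hp, hq, i] <;> rfl
  have e2 : p'.trans q' =
      (((Path.refl 0).prod i).trans (i.prod (Path.refl 1))).map Q.continuous := by
    rw [Path.map_trans]; congr 1 <;> ext t <;> simp [hp', hq', i] <;> rfl
  rw [e1, e2]
  refine Path.Homotopic.map ?_ Q
  rw [← Path.Homotopic.Quotient.eq]
  simp only [Path.trans_prod_eq_prod_trans]
  -- In the square itself, both boundary paths deform to the diagonal by removing the constant half
  -- in each coordinate.
  have h : ((i.trans (Path.refl 1)).prod ((Path.refl 0).trans i)).Homotopic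
      (i.prod i) := ⟨Path.Homotopic.prodHomotopy (Path.Homotopy.transRefl i)
        (Path.Homotopy.reflTrans i)⟩
  have h' : (((Path.refl 0).trans i).prod (i.trans (Path.refl 1))).Homotopic
      (i.prod i) := ⟨Path.Homotopic.prodHomotopy (Path.Homotopy.reflTrans i)
        (Path.Homotopy.transRefl i)⟩
  exact Path.Homotopic.Quotient.eq.2 (h.trans h'.symm)

/-- Postcomposition of a path of maps. -/
def Path.post {u v : C(A, Y)} (γ : Path u v) (Φ : C(Y, Z)) : Path (Φ.comp u) (Φ.comp v) :=
  γ.map (ContinuousMap.continuous_postcomp Φ)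

/-- Precomposition of a path of maps. -/
def Path.pre {u v : C(A, Y)} (γ : Path u v) (α : C(B, A)) : Path (u.comp α) (v.comp α) :=
  γ.map (ContinuousMap.continuous_precomp α)

/-- Interchange law: both sides bound the square (s, t) ↦ γ s ∘ T t, which is continuous because
composition through the locally compact space `A` is. -/
theorem Path.pre_trans_post [LocallyCompactSpace A] {u v : C(A, Z)} {α α' : C(B, A)}
    (γ : Path u v) (T : Path α α') :
    ((γ.pre α).trans (T.post v)).Homotopic ((T.post u).trans (γ.pre α')) := by
  refine Path.homotopic_of_square ⟨fun q => (γ q.1).comp (T q.2), ?_⟩ _ _ _ _ ?_ ?_ ?_ ?_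
  · exact Continuous.compCM (by fun_prop) (by fun_prop)
  all_goals intro t; simp [Path.pre, Path.post]

/-- A homotopy as a path of maps, after restriction along `f`. -/
def ContinuousMap.Homotopy.path {u v : C(Y, Z)} (U : Homotopy u v) (f : C(A, Y)) :
    Path (u.comp f) (v.comp f) where
  toFun := (U.toContinuousMap.comp ((ContinuousMap.id I).prodMap f)).curry
  continuous_toFun := map_continuous _
  source' := by ext; simp
  target' := by ext; simp

@[simp] theorem ContinuousMap.Homotopy.path_apply {u v : C(Y, Z)} (U : Homotopy u v) (f : C(A, Y))
    (t : I) (a : A) : U.path f t a = U (t, f a) := rfl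

end Paths

/-! ### Double mapping cylinders, and homotopies of maps out of them. -/

section DoubleCylinder

universe uX uA uP

variable {X : Type uX} {A : Type uA} {P : Type uP} [TopologicalSpace X] [TopologicalSpace A]
  [TopologicalSpace P] {Z : Type*} [TopologicalSpace Z]

/-- The identifications of the double mapping cylinder of `X ← A → P`. -/
inductive DoubleCylinderRel (f : C(A, X)) (g : C(A, P)) :
    (X ⊕ P) ⊕ (A × I) → (X ⊕ P) ⊕ (A × I) → Prop
  | left (a : A) : DoubleCylinderRel f g (Sum.inl (Sum.inl (f a))) (Sum.inr (a, 0))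
  | right (a : A) : DoubleCylinderRel f g (Sum.inl (Sum.inr (g a))) (Sum.inr (a, 1))

/-- The double mapping cylinder of `X ← A → P`. -/
def DoubleCylinder (f : C(A, X)) (g : C(A, P)) : Type (max uX uA uP) :=
  Quot (DoubleCylinderRel f g)

namespace DoubleCylinder

variable (f : C(A, X)) (g : C(A, P))

instance : TopologicalSpace (DoubleCylinder f g) :=
  inferInstanceAs (TopologicalSpace (Quot (DoubleCylinderRel f g)))

/-- The inclusion of the left end. -/
def inl : C(X, DoubleCylinder f g) :=
  ⟨fun x => Quot.mk _ (Sum.inl (Sum.inl x)),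
    continuous_quot_mk.comp (continuous_inl.comp continuous_inl)⟩

/-- The inclusion of the right end. -/
def inr : C(P, DoubleCylinder f g) :=
  ⟨fun x => Quot.mk _ (Sum.inl (Sum.inr x)),
    continuous_quot_mk.comp (continuous_inl.comp continuous_inr)⟩

/-- The cylinder part. -/
def seg : C(A × I, DoubleCylinder f g) :=
  ⟨fun x => Quot.mk _ (Sum.inr x), continuous_quot_mk.comp continuous_inr⟩

theorem seg_zero (a : A) : seg f g (a, 0) = inl f g (f a) :=
  (Quot.sound (DoubleCylinderRel.left a)).symm

theorem seg_one (a : A) : seg f g (a, 1) = inr f g (g a) :=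
  (Quot.sound (DoubleCylinderRel.right a)).symm

variable {f g}

theorem ind {motive : DoubleCylinder f g → Prop} (h1 : ∀ x, motive (inl f g x))
    (h2 : ∀ p, motive (inr f g p)) (h3 : ∀ a t, motive (seg f g (a, t))) (y) : motive y := by
  rcases y with ⟨(x | p) | ⟨a, t⟩⟩
  exacts [h1 x, h2 p, h3 a t]

theorem hom_ext {φ ψ : C(DoubleCylinder f g, Z)} (h1 : ∀ x, φ (inl f g x) = ψ (inl f g x))
    (h2 : ∀ p, φ (inr f g p) = ψ (inr f g p))
    (h3 : ∀ a t, φ (seg f g (a, t)) = ψ (seg f g (a, t))) : φ = ψ :=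
  ContinuousMap.ext fun y => ind (motive := fun y => φ y = ψ y) h1 h2 h3 y

/-- Maps out of the double mapping cylinder. -/
def lift (u : C(X, Z)) (w : C(P, Z)) (q : C(A × I, Z)) (h0 : ∀ a, q (a, 0) = u (f a))
    (h1 : ∀ a, q (a, 1) = w (g a)) : C(DoubleCylinder f g, Z) where
  toFun := Quot.lift (Sum.elim (Sum.elim u w) q) (by
    rintro _ _ (a | a)
    · simp [h0]
    · simp [h1])
  continuous_toFun := continuous_quot_lift _ (by fun_prop)

section

variable (u : C(X, Z)) (w : C(P, Z)) (q : C(A × I, Z)) (h0 : ∀ a, q (a, 0) = u (f a))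
    (h1 : ∀ a, q (a, 1) = w (g a))

@[simp] theorem lift_inl (x : X) : lift u w q h0 h1 (inl f g x) = u x := rfl
@[simp] theorem lift_inr (x : P) : lift u w q h0 h1 (inr f g x) = w x := rfl
@[simp] theorem lift_seg (x : A × I) : lift u w q h0 h1 (seg f g x) = q x := rfl

end

/-- A homotopy of maps out of the double mapping cylinder consists of compatible homotopies on the
two ends and on the cylinder. -/
theorem homotopic_of {φ ψ : C(DoubleCylinder f g, Z)} (U : C(I × X, Z)) (W : C(I × P, Z))
    (Q : C(I × (A × I), Z)) (hQ0 : ∀ s a, Q (s, (a, 0)) = U (s, f a))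
    (hQ1 : ∀ s a, Q (s, (a, 1)) = W (s, g a))
    (hU0 : ∀ x, φ (inl f g x) = U (0, x)) (hU1 : ∀ x, ψ (inl f g x) = U (1, x))
    (hW0 : ∀ x, φ (inr f g x) = W (0, x)) (hW1 : ∀ x, ψ (inr f g x) = W (1, x))
    (hq0 : ∀ x t, φ (seg f g (x, t)) = Q (0, (x, t)))
    (hq1 : ∀ x t, ψ (seg f g (x, t)) = Q (1, (x, t))) : φ.Homotopic ψ := by
  let H : I × DoubleCylinder f g → Z := fun y =>
    Quot.lift (Sum.elim (Sum.elim (fun x => U (y.1, x)) (fun x => W (y.1, x)))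
      (fun x => Q (y.1, x))) (by
        rintro _ _ (a | a)
        · simp [hQ0]
        · simp [hQ1]) y.2
  have hH : Continuous H := by
    have hq : Topology.IsQuotientMap
        (Quot.mk (DoubleCylinderRel f g) : _ → DoubleCylinder f g) := isQuotientMap_quot_mk
    -- Since `I` is locally compact, continuity may be tested before passing to the quotient; there
    -- the three pieces are curried so that they form a map out of a disjoint sum.
    refine hq.continuous_lift_prod_right ?_
    let K : C((X ⊕ P) ⊕ (A × I), C(I, Z)) :=
      ⟨Sum.elim (Sum.elim (U.comp prodSwap).curry (W.comp prodSwap).curry)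
        (Q.comp prodSwap).curry, by fun_prop⟩
    have hK := (continuous_uncurry_of_continuous K).comp
      (continuous_swap (X := I) (Y := (X ⊕ P) ⊕ (A × I)))
    refine hK.congr ?_
    rintro ⟨s, (x | p) | x⟩ <;> rfl
  refine ⟨⟨⟨H, hH⟩, ?_, ?_⟩⟩
  · exact ind (fun x => (hU0 x).symm) (fun x => (hW0 x).symm) (fun a t => (hq0 a t).symm)
  · exact ind (fun x => (hU1 x).symm) (fun x => (hW1 x).symm) (fun a t => (hq1 a t).symm)

section LocallyCompact

variable [LocallyCompactSpace A]

/-- The map out of the double mapping cylinder given by a path of maps. -/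
def desc (u : C(X, Z)) (w : C(P, Z)) (γ : Path (u.comp f) (w.comp g)) : C(DoubleCylinder f g, Z) :=
  lift u w ((ContinuousMap.uncurry γ.toContinuousMap).comp prodSwap)
    (fun a => by simp) (fun a => by simp)

@[simp] theorem desc_inl (u : C(X, Z)) (w : C(P, Z)) (γ : Path (u.comp f) (w.comp g)) (x : X) :
    desc u w γ (inl f g x) = u x := rfl
@[simp] theorem desc_inr (u : C(X, Z)) (w : C(P, Z)) (γ : Path (u.comp f) (w.comp g)) (x : P) :
    desc u w γ (inr f g x) = w x := rfl
@[simp] theorem desc_seg (u : C(X, Z)) (w : C(P, Z)) (γ : Path (u.comp f) (w.comp g)) (a : A)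
    (t : I) : desc u w γ (seg f g (a, t)) = γ t a := rfl

/-- A version of `homotopic_of` for maps given by paths. -/
theorem desc_homotopic_of {u u' : C(X, Z)} {w w' : C(P, Z)} {γ : Path (u.comp f) (w.comp g)}
    {γ' : Path (u'.comp f) (w'.comp g)} (U : Homotopy u u') (W : Homotopy w w')
    (Q : C(I × I, C(A, Z))) (hQ0 : ∀ s a, Q (s, 0) a = U (s, f a))
    (hQ1 : ∀ s a, Q (s, 1) a = W (s, g a)) (h0 : ∀ t, γ t = Q (0, t)) (h1 : ∀ t, γ' t = Q (1, t)) :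
    (desc u w γ).Homotopic (desc u' w' γ') := by
  refine homotopic_of U.toContinuousMap W.toContinuousMap
    ((ContinuousMap.uncurry Q).comp ⟨fun x => ((x.1, x.2.2), x.2.1), by fun_prop⟩)
    hQ0 hQ1 ?_ ?_ ?_ ?_ ?_ ?_ <;> simp [h0, h1]

theorem desc_congr {u : C(X, Z)} {w : C(P, Z)} {γ γ' : Path (u.comp f) (w.comp g)}
    (h : γ.Homotopic γ') : (desc u w γ).Homotopic (desc u w γ') := by
  obtain ⟨F⟩ := h
  refine desc_homotopic_of (ContinuousMap.Homotopy.refl u) (ContinuousMap.Homotopy.refl w) F.toContinuousMap ?_ ?_ ?_ ?_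
  · intro s a; exact congrArg (fun k : C(A, Z) => k a) (F.source s)
  · intro s a; exact congrArg (fun k : C(A, Z) => k a) (F.target s)
  · intro t; exact (F.map_zero_left t).symm
  · intro t; exact (F.map_one_left t).symm

/-- At time s the left end has moved along `U` to U_s, and the cylinder carries only the remaining
part of `U`, from s to 1, before `γ`. At s = 1 that part is constant. -/
theorem desc_slide_left {u u' : C(X, Z)} {w : C(P, Z)} (U : Homotopy u u')
    (γ : Path (u'.comp f) (w.comp g)) :
    (desc u w ((U.path f).trans γ)).Homotopic (desc u' w ((Path.refl _).trans γ)) := by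
  let T (s : I) : Path (U.path f s : C(A, Z)) (u'.comp f) :=
    ((U.path f).subpath s 1).cast rfl (by simp)
  let S (s : I) : Path (U.path f s : C(A, Z)) (w.comp g) := (T s).trans γ
  have hS : Continuous fun x : I × I => (S x.1 x.2 : C(A, Z)) := by
    refine Path.trans_continuous_family T ?_ (fun _ => γ) ?_
    · exact (U.path f).subpath_continuous_family.comp (by fun_prop : Continuous
        fun x : I × I => (x.1, (1 : I), x.2))
    · exact γ.continuous.comp continuous_snd
  refine desc_homotopic_of U (ContinuousMap.Homotopy.refl w) ⟨_, hS⟩ ?_ ?_ ?_ ?_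
  · intro s a; simp
  · intro s a; simp
  · intro t
    simp [S, T, Path.trans_apply]
  · intro t
    simp [S, T, Path.trans_apply]

/-- Mirror image of `desc_slide_left`: at time s the path is prolonged by the part of `W` already
travelled, from 0 to s. -/
theorem desc_slide_right {u : C(X, Z)} {w w' : C(P, Z)} (W : Homotopy w w')
    (γ : Path (u.comp f) (w.comp g)) :
    (desc u w (γ.trans (Path.refl _))).Homotopic (desc u w' (γ.trans (W.path g))) := by
  let T (s : I) : Path (w.comp g) (W.path g s : C(A, Z)) :=
    ((W.path g).subpath 0 s).cast (by simp) rfl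
  let S (s : I) : Path (u.comp f) (W.path g s : C(A, Z)) := γ.trans (T s)
  have hS : Continuous fun x : I × I => (S x.1 x.2 : C(A, Z)) := by
    refine Path.trans_continuous_family (fun _ => γ) ?_ T ?_
    · exact γ.continuous.comp continuous_snd
    · exact (W.path g).subpath_continuous_family.comp (by fun_prop : Continuous
        fun x : I × I => ((0 : I), x.1, x.2))
  refine desc_homotopic_of (ContinuousMap.Homotopy.refl u) W ⟨_, hS⟩ ?_ ?_ ?_ ?_
  · intro s a; simp
  · intro s a; simp
  · intro t
    simp [S, T, Path.trans_apply]
  · intro t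
    simp [S, T, Path.trans_apply]

/-- Push `W` into the path at the right end, deform by `h`, then release `U` at the left end. Only a
square commuting up to homotopy is needed, so the later comparisons become path algebra. -/
theorem desc_homotopic {u u' : C(X, Z)} {w w' : C(P, Z)} {γ : Path (u.comp f) (w.comp g)}
    {γ' : Path (u'.comp f) (w'.comp g)} (U : Homotopy u u') (W : Homotopy w w')
    (h : (γ.trans (W.path g)).Homotopic ((U.path f).trans γ')) :
    (desc u w γ).Homotopic (desc u' w' γ') :=
  (desc_congr ⟨(Path.Homotopy.transRefl γ).symm⟩).trans <|
    (desc_slide_right W γ).trans <| (desc_congr h).trans <|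
    (desc_slide_left U γ').trans (desc_congr ⟨Path.Homotopy.reflTrans γ'⟩)

end LocallyCompact

end DoubleCylinder

end DoubleCylinder

/-! ### Groupoid identities for paths. -/

section PathAlgebra

variable {Y : Type*} [TopologicalSpace Y]

theorem Path.homotopic_assoc₅ {a b c e i j : Y} (H₁ : Path a b) (H₂ : Path b c) (C : Path c e)
    (K₂ : Path i e) (K₁ : Path j i) :
    (H₁.trans ((H₂.trans (C.trans K₂.symm)).trans K₁.symm)).Homotopic
      ((H₁.trans H₂).trans (C.trans (K₁.trans K₂).symm)) := by
  rw [← Path.Homotopic.Quotient.eq, Path.trans_symm]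
  simp only [Path.Homotopic.Quotient.mk_trans, Path.Homotopic.Quotient.trans_assoc]

theorem Path.Homotopic.Quotient.trans_symm_cancel {a b c : Y} (p : Path.Homotopic.Quotient b a)
    (q : Path.Homotopic.Quotient b c) : p.trans (p.symm.trans q) = q := by
  rw [← Path.Homotopic.Quotient.trans_assoc, Path.Homotopic.Quotient.trans_symm, Path.Homotopic.Quotient.refl_trans]

/-- The identity needed by `isHEquiv_map_endo`: `X` and its inverse cancel, and `h` carries `C` past
`T`, which then cancels too. -/
theorem Path.homotopic_conj {a b c e i j b' c' : Y} (H : Path a b) (C : Path b c) (K : Path e c)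
    (G : Path e i) (X : Path a j) (F : Path b b') (C' : Path b' c') (T : Path c c')
    (h : (C.trans T).Homotopic (F.trans C')) :
    ((H.trans (C.trans K.symm)).trans G).Homotopic
      (X.trans ((X.symm.trans (H.trans F)).trans (C'.trans (G.symm.trans (K.trans T)).symm))) := by
  rw [← Path.Homotopic.Quotient.eq] at h ⊢
  have h' : (Path.Homotopic.Quotient.mk F).trans (Path.Homotopic.Quotient.mk C') = (Path.Homotopic.Quotient.mk C).trans (Path.Homotopic.Quotient.mk T) := h.symm
  have h'' : ∀ {z : Y} (q : Path.Homotopic.Quotient c' z), (Path.Homotopic.Quotient.mk F).trans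
      ((Path.Homotopic.Quotient.mk C').trans q) = (Path.Homotopic.Quotient.mk C).trans ((Path.Homotopic.Quotient.mk T).trans q) := by
    intro z q
    rw [← Path.Homotopic.Quotient.trans_assoc, h', Path.Homotopic.Quotient.trans_assoc]
  simp only [Path.trans_symm, Path.symm_symm, Path.Homotopic.Quotient.mk_trans, Path.Homotopic.Quotient.mk_symm,
    Path.Homotopic.Quotient.trans_assoc, Path.Homotopic.Quotient.trans_symm_cancel, h'']

theorem Path.homotopic_cancel {a b c e : Y} (H : Path a b) (C : Path a c) (K : Path c e) :
    ((H.trans H.symm).trans (C.trans (K.trans K.symm).symm)).Homotopic C := by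
  rw [← Path.Homotopic.Quotient.eq]
  simp only [Path.trans_symm, Path.symm_symm, Path.Homotopic.Quotient.mk_trans, Path.Homotopic.Quotient.mk_symm,
    Path.Homotopic.Quotient.trans_symm, Path.Homotopic.Quotient.refl_trans, Path.Homotopic.Quotient.trans_refl]

variable {A B Z : Type*} [TopologicalSpace A] [TopologicalSpace B] [TopologicalSpace Z]

theorem Path.post_trans {u v w : C(A, Y)} (γ : Path u v) (γ' : Path v w) (Φ : C(Y, Z)) :
    (γ.trans γ').post Φ = (γ.post Φ).trans (γ'.post Φ) :=
  Path.map_trans _ _ _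

theorem Path.pre_trans {u v w : C(A, Y)} (γ : Path u v) (γ' : Path v w) (α : C(B, A)) :
    (γ.trans γ').pre α = (γ.pre α).trans (γ'.pre α) :=
  Path.map_trans _ _ _

theorem ContinuousMap.Homotopic.nonempty_path {u v : C(A, Y)} (h : u.Homotopic v) :
    Nonempty (Path u v) :=
  h.map fun U => U.path (ContinuousMap.id A)

theorem Path.toHomotopic [LocallyCompactSpace A] {u v : C(A, Y)} (γ : Path u v) : u.Homotopic v :=
  ⟨⟨ContinuousMap.uncurry γ.toContinuousMap, fun a => by simp, fun a => by simp⟩⟩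

end PathAlgebra

/-! ### Homotopy invariance of double mapping cylinders, and comparison with pushouts. -/

namespace DoubleCylinder

variable {X A P X' A' P' X'' A'' P'' Y Z : Type*} [TopologicalSpace X] [TopologicalSpace A]
  [TopologicalSpace P] [TopologicalSpace X'] [TopologicalSpace A'] [TopologicalSpace P']
  [TopologicalSpace X''] [TopologicalSpace A''] [TopologicalSpace P'']
  [TopologicalSpace Y] [TopologicalSpace Z]
  {f : C(A, X)} {g : C(A, P)} {f' : C(A', X')} {g' : C(A', P')} {f'' : C(A'', X'')}
  {g'' : C(A'', P'')}
  [LocallyCompactSpace A] [LocallyCompactSpace A'] [LocallyCompactSpace A'']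

variable (f g) in
omit [LocallyCompactSpace A] in
/-- The tautological path from the left end to the right end. -/
def cyl : Path ((inl f g).comp f) ((inr f g).comp g) where
  toFun := ((seg f g).comp prodSwap).curry
  continuous_toFun := map_continuous _
  source' := by ext a; exact seg_zero f g a
  target' := by ext a; exact seg_one f g a

theorem desc_cyl : desc (inl f g) (inr f g) (cyl f g) = ContinuousMap.id _ :=
  hom_ext (fun _ => rfl) (fun _ => rfl) (fun _ _ => rfl)

theorem comp_desc (Φ : C(Z, Y)) (u : C(X, Z)) (w : C(P, Z)) (γ : Path (u.comp f) (w.comp g)) :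
    Φ.comp (desc u w γ) = desc (Φ.comp u) (Φ.comp w) (γ.post Φ) :=
  hom_ext (fun _ => rfl) (fun _ => rfl) (fun _ _ => rfl)

/-- The path defining `DoubleCylinder.map`. -/
noncomputable def mapPath (x : C(X, X')) (α : C(A, A')) (p : C(P, P')) (h : Path (x.comp f) (f'.comp α))
    (k : Path (p.comp g) (g'.comp α)) :
    Path (((inl f' g').comp x).comp f) (((inr f' g').comp p).comp g) :=
  Path.trans (y := ((inl f' g').comp f').comp α) (h.post (inl f' g'))
    (Path.trans (y := ((inr f' g').comp g').comp α) ((cyl f' g').pre α)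
      (k.post (inr f' g')).symm)

/-- The map of double mapping cylinders induced by a map of diagrams commuting up to homotopy. -/
noncomputable def map (x : C(X, X')) (α : C(A, A')) (p : C(P, P')) (h : Path (x.comp f) (f'.comp α))
    (k : Path (p.comp g) (g'.comp α)) : C(DoubleCylinder f g, DoubleCylinder f' g') :=
  desc ((inl f' g').comp x) ((inr f' g').comp p) (mapPath x α p h k)

omit [LocallyCompactSpace A''] in
theorem map_comp_map (x : C(X, X')) (α : C(A, A')) (p : C(P, P'))
    (h : Path (x.comp f) (f'.comp α)) (k : Path (p.comp g) (g'.comp α))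
    (x' : C(X', X'')) (α' : C(A', A'')) (p' : C(P', P''))
    (h' : Path (x'.comp f') (f''.comp α')) (k' : Path (p'.comp g') (g''.comp α')) :
    ((map x' α' p' h' k').comp (map x α p h k)).Homotopic
      (map (x'.comp x) (α'.comp α) (p'.comp p) (Path.trans (y := (x'.comp f').comp α)
        (h.post x') (h'.pre α)) (Path.trans (y := (p'.comp g').comp α) (k.post p') (k'.pre α))) := by
  have e1 : (map x' α' p' h' k').comp (map x α p h k) = desc ((inl f'' g'').comp (x'.comp x))
      ((inr f'' g'').comp (p'.comp p)) (Path.trans (y := ((inl f'' g'').comp (x'.comp f')).comp α)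
        (h.post ((inl f'' g'').comp x')) (Path.trans (y := ((inr f'' g'').comp (p'.comp g')).comp α)
          ((mapPath x' α' p' h' k').pre α) (k.post ((inr f'' g'').comp p')).symm)) := by
    change _ = desc _ _ _
    change (map x' α' p' h' k').comp (desc _ _ (mapPath x α p h k)) = _
    rw [comp_desc, mapPath, Path.post_trans, Path.post_trans]
    rfl
  rw [e1]
  refine desc_congr (u := (inl f'' g'').comp (x'.comp x)) (w := (inr f'' g'').comp (p'.comp p))
    (γ' := mapPath (x'.comp x) (α'.comp α) (p'.comp p) _ _) ?_
  rw [mapPath, mapPath, Path.pre_trans, Path.pre_trans, Path.post_trans, Path.post_trans]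
  exact Path.homotopic_assoc₅ (h.post ((inl f'' g'').comp x')) ((h'.post (inl f'' g'')).pre α)
    ((cyl f'' g'').pre (α'.comp α)) ((k'.post (inr f'' g'')).pre α) (k.post ((inr f'' g'').comp p'))

/-- Such a map need not be homotopic to the identity, since `h` and `k` may be nontrivial loops;
reversing both loops gives its inverse. -/
theorem isHEquiv_map_id (h : Path ((ContinuousMap.id X).comp f) (f.comp (ContinuousMap.id A)))
    (k : Path ((ContinuousMap.id P).comp g) (g.comp (ContinuousMap.id A))) :
    IsHEquiv (map (ContinuousMap.id X) (ContinuousMap.id A) (ContinuousMap.id P) h k) := by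
  -- Both endpoints of `h` are definitionally `f`, so `h.symm` can play the role of `h`. Recording
  -- the reversal as an equation lets the same statement serve for both composites.
  have key : ∀ (h h' : Path ((ContinuousMap.id X).comp f) (f.comp (ContinuousMap.id A)))
      (k k' : Path ((ContinuousMap.id P).comp g) (g.comp (ContinuousMap.id A))),
      h.symm = h' → k.symm = k' →
      ((map (f := f) (g := g) (ContinuousMap.id X) (ContinuousMap.id A) (ContinuousMap.id P)
        h' k').comp
        (map (ContinuousMap.id X) (ContinuousMap.id A) (ContinuousMap.id P) h k)).Homotopic
        (ContinuousMap.id _) := by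
    rintro h _ k _ rfl rfl
    refine (map_comp_map _ _ _ _ _ _ _ _ _ _).trans ?_
    rw [← desc_cyl (f := f) (g := g)]
    refine desc_congr ?_
    rw [mapPath, Path.post_trans, Path.post_trans]
    exact Path.homotopic_cancel (h.post (inl f g)) (cyl f g) (k.post (inr f g))
  exact ⟨_, key h _ k _ rfl rfl, key _ h _ k (Path.symm_symm h) (Path.symm_symm k)⟩

/-- Transporting `h` and `k` along the three homotopies to the identities gives loops at `f` and
`g`. The map is homotopic to the one induced by identities and these loops. -/
theorem isHEquiv_map_endo {x : C(X, X)} {α : C(A, A)} {p : C(P, P)}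
    (hx : x.Homotopic (ContinuousMap.id X)) (hα : α.Homotopic (ContinuousMap.id A))
    (hp : p.Homotopic (ContinuousMap.id P)) (h : Path (x.comp f) (f.comp α))
    (k : Path (p.comp g) (g.comp α)) : IsHEquiv (map x α p h k) := by
  obtain ⟨U⟩ := hx
  obtain ⟨W⟩ := hp
  obtain ⟨T⟩ := hα.nonempty_path
  refine (isHEquiv_map_id ((U.path f).symm.trans (h.trans (T.post f)))
    ((W.path g).symm.trans (k.trans (T.post g)))).congr (Homotopic.symm ?_)
  refine desc_homotopic ((ContinuousMap.Homotopy.refl (inl f g)).comp U)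
    ((ContinuousMap.Homotopy.refl (inr f g)).comp W) ?_
  rw [mapPath, mapPath, Path.post_trans, Path.post_trans, Path.post_trans, Path.post_trans]
  exact Path.homotopic_conj (h.post (inl f g)) ((cyl f g).pre α) (k.post (inr f g))
    ((W.path g).post (inr f g)) ((U.path f).post (inl f g)) ((T.post f).post (inl f g))
    (cyl f g) ((T.post g).post (inr f g)) (Path.pre_trans_post (cyl f g) T)

/-- The gluing theorem: a map of diagrams commuting up to homotopy whose components are homotopy
equivalences induces a homotopy equivalence of double mapping cylinders. -/
theorem isHEquiv_map {x : C(X, X')} {α : C(A, A')} {p : C(P, P')}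
    (hx : IsHEquiv x) (hα : IsHEquiv α) (hp : IsHEquiv p) (h : Path (x.comp f) (f'.comp α))
    (k : Path (p.comp g) (g'.comp α)) : IsHEquiv (map x α p h k) := by
  obtain ⟨y, hyx, hxy⟩ := hx
  obtain ⟨β, hβα, hαβ⟩ := hα
  obtain ⟨q, hqp, hpq⟩ := hp
  -- The inverses commute with the diagrams up to homotopy: y f' ≃ y f' α β ≃ y x f β ≃ f β.
  have h' : (y.comp f').Homotopic (f.comp β) := by
    have e1 : ((y.comp f').comp (α.comp β)).Homotopic (y.comp f') :=
      (Homotopic.refl (y.comp f')).comp hαβ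
    have e2 : ((y.comp (x.comp f)).comp β).Homotopic ((y.comp (f'.comp α)).comp β) :=
      ((Homotopic.refl y).comp h.toHomotopic).comp (Homotopic.refl β)
    have e3 : ((y.comp x).comp (f.comp β)).Homotopic (f.comp β) := hyx.comp (Homotopic.refl _)
    exact e1.symm.trans (e2.symm.trans e3)
  have k' : (q.comp g').Homotopic (g.comp β) := by
    have e1 : ((q.comp g').comp (α.comp β)).Homotopic (q.comp g') :=
      (Homotopic.refl (q.comp g')).comp hαβ
    have e2 : ((q.comp (p.comp g)).comp β).Homotopic ((q.comp (g'.comp α)).comp β) :=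
      ((Homotopic.refl q).comp k.toHomotopic).comp (Homotopic.refl β)
    have e3 : ((q.comp p).comp (g.comp β)).Homotopic (g.comp β) := hqp.comp (Homotopic.refl _)
    exact e1.symm.trans (e2.symm.trans e3)
  obtain ⟨h'⟩ := h'.nonempty_path
  obtain ⟨k'⟩ := k'.nonempty_path
  -- The homotopies `h'`, `k'` are unrelated to `h`, `k`, so the composites are not claimed to be
  -- homotopic to identities; it suffices that both are equivalences.
  exact IsHEquiv.of_comp (ψ := map y β q h' k')
    ((isHEquiv_map_endo hyx hβα hqp _ _).congr (map_comp_map _ _ _ _ _ _ _ _ _ _).symm)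
    ((isHEquiv_map_endo hxy hαβ hpq _ _).congr (map_comp_map _ _ _ _ _ _ _ _ _ _).symm)

theorem nonempty_homotopyEquiv {x : C(X, X')} {α : C(A, A')} {p : C(P, P')}
    (hx : IsHEquiv x) (hα : IsHEquiv α) (hp : IsHEquiv p)
    (h : (x.comp f).Homotopic (f'.comp α)) (k : (p.comp g).Homotopic (g'.comp α)) :
    Nonempty (DoubleCylinder f g ≃ₕ DoubleCylinder f' g') :=
  let ⟨h⟩ := h.nonempty_path
  let ⟨k⟩ := k.nonempty_path
  (isHEquiv_map hx hα hp h k).nonempty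

omit [LocallyCompactSpace A] [TopologicalSpace Z] in
theorem factorsThrough_of_pushout {Q : Type*} {i : X → Q} {j : P → Q} (hi : Function.Injective i)
    (hji : ∀ p x, j p = i x → ∃ a, g a = p ∧ f a = x)
    (hj : ∀ p p', j p = j p' → p = p' ∨ ∃ a a', g a = p ∧ g a' = p' ∧ f a = f a')
    {u : X → Z} {w : P → Z} (huw : ∀ a, u (f a) = w (g a)) :
    Function.FactorsThrough (Sum.elim u w) (Sum.elim i j) := by
  rintro (x | p) (x' | p') h
  · exact congrArg u (hi h)
  · obtain ⟨a, rfl, rfl⟩ := hji p' x h.symm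
    exact huw a
  · obtain ⟨a, rfl, rfl⟩ := hji p x' h
    exact (huw a).symm
  · obtain rfl | ⟨a, a', rfl, rfl, haa⟩ := hj p p' h
    · rfl
    · exact (huw a).symm.trans ((congrArg u haa).trans (huw a'))

omit [LocallyCompactSpace A] in
/-- If `A → P` has the homotopy extension property for the tautological homotopy, then the double
mapping cylinder of `X ← A → P` is homotopy equivalent to the pushout `Q`. -/
theorem nonempty_homotopyEquiv_pushout {Q : Type*} [TopologicalSpace Q] (i : C(X, Q)) (j : C(P, Q))
    (hij : ∀ a, i (f a) = j (g a)) (hq : Topology.IsQuotientMap (Sum.elim i j))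
    (hi : Function.Injective i) (hji : ∀ p x, j p = i x → ∃ a, g a = p ∧ f a = x)
    (hj : ∀ p p', j p = j p' → p = p' ∨ ∃ a a', g a = p ∧ g a' = p' ∧ f a = f a')
    (G : C(P × I, DoubleCylinder f g)) (hG0 : ∀ p, G (p, 0) = inr f g p)
    (hG : ∀ a t, G (g a, t) = seg f g (a, σ t)) : Nonempty (DoubleCylinder f g ≃ₕ Q) := by
  let κ : C(DoubleCylinder f g, Q) := lift i j ((i.comp f).comp ContinuousMap.fst)
    (fun _ => rfl) hij
  let π : C(X ⊕ P, Q) := ⟨Sum.elim i j, hq.continuous⟩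
  have hπ : Topology.IsQuotientMap π := hq
  -- At time 1 the extended homotopy has pulled g a back to the left end f a, so `G1` agrees with
  -- `inl` over `A` and descends to `Q`.
  let G1 : C(P, DoubleCylinder f g) := ⟨fun p => G (p, 1), by fun_prop⟩
  let u : C(X ⊕ P, DoubleCylinder f g) := ⟨Sum.elim (inl f g) G1, by fun_prop⟩
  have hu : Function.FactorsThrough u π := factorsThrough_of_pushout hi hji hj (by
    intro a; simp [G1, hG, seg_zero])
  let ψ : C(Q, DoubleCylinder f g) := hπ.lift u hu
  have hψ : ∀ y, ψ (π y) = u y := fun y => congrArg (fun F : C(X ⊕ P, _) => F y) (hπ.lift_comp u hu)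
  have hψi : ∀ x, ψ (i x) = inl f g x := fun x => hψ (Sum.inl x)
  have hψj : ∀ p, ψ (j p) = G (p, 1) := fun p => hψ (Sum.inr p)
  let Gσ : C(P × I, Q) := κ.comp (G.comp ((ContinuousMap.id P).prodMap ⟨σ, by fun_prop⟩))
  let v : C(X ⊕ P, C(I, Q)) :=
    ⟨Sum.elim (i.comp ContinuousMap.fst : C(X × I, Q)).curry Gσ.curry, by fun_prop⟩
  have hv : Function.FactorsThrough v π := factorsThrough_of_pushout hi hji hj (by
    intro a; ext t; simp [Gσ, hG, κ])
  let H : C(Q, C(I, Q)) := hπ.lift v hv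
  have hH : ∀ y, H (π y) = v y := fun y =>
    congrArg (fun F : C(X ⊕ P, C(I, Q)) => F y) (hπ.lift_comp v hv)
  refine ⟨⟨κ, ψ, ?_, ?_⟩⟩
  -- Run `G` backwards on `P`; on the cylinder the height t becomes s t, which matches `G` at t = 1.
  · refine homotopic_of ((inl f g).comp ContinuousMap.snd)
      (G.comp ⟨fun x => (x.2, σ x.1), by fun_prop⟩)
      ((seg f g).comp ⟨fun x => (x.2.1, x.1 * x.2.2), by fun_prop⟩) ?_ ?_ ?_ ?_ ?_ ?_ ?_ ?_
    · intro s a; simp [seg_zero]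
    · intro s a; simp [hG]
    · intro x; simp [κ, hψi]
    · intro x; simp
    · intro x; simp [κ, hψj]
    · intro x; simp [hG0]
    · intro x t; simp [κ, hψi, seg_zero]
    · intro x t; simp
  · refine ⟨⟨(ContinuousMap.uncurry H).comp prodSwap, ?_, ?_⟩⟩
    · intro y
      obtain ⟨(x | p), rfl⟩ := hπ.surjective y
      · change H (π (Sum.inl x)) 0 = κ (ψ (i x))
        rw [hH, hψi]; simp [v, κ]
      · change H (π (Sum.inr p)) 0 = κ (ψ (j p))
        rw [hH, hψj]; simp [v, Gσ]
    · intro y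
      obtain ⟨(x | p), rfl⟩ := hπ.surjective y
      · change H (π (Sum.inl x)) 1 = i x
        rw [hH]; simp [v]
      · change H (π (Sum.inr p)) 1 = j p
        rw [hH]; simp [v, Gσ, hG0, κ]

end DoubleCylinder

/-! ### Topology of geometric realizations. -/

namespace PreAbstractSimplicialComplex

variable {V : Type*} {K M : PreAbstractSimplicialComplex V}

theorem mem_of_subset {s t : Finset V} (hs : s ∈ K) (hts : t ⊆ s) (ht : t.Nonempty) : t ∈ K :=
  (K.isRelLowerSet_faces hs).2 hts ht

theorem nonempty_of_mem {s : Finset V} (hs : s ∈ K) : s.Nonempty :=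
  (K.isRelLowerSet_faces hs).1

namespace Realization

variable {Y Z : Type*} [TopologicalSpace Y] [TopologicalSpace Z]

theorem ext_coord {x y : K.Realization} (h : ∀ v, x.1 v = y.1 v) : x = y :=
  Subtype.ext (Finsupp.ext h)

theorem inclusion_injective (h : K ≤ M) : Function.Injective (inclusion h) := fun _ _ hxy =>
  ext_coord fun v => congrArg (fun z : M.Realization => z.1 v) hxy

theorem continuous_val_closedSimplex {s : Finset V} (hs : s ∈ K) :
    Continuous (fun x : ClosedSimplex K s => x.1) :=
  continuous_iff_coinduced_le.2 (le_iSup (fun s : {s : Finset V // s ∈ K} =>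
    TopologicalSpace.coinduced (fun x : ClosedSimplex K s.1 => x.1) inferInstance) ⟨s, hs⟩)

theorem isOpen_iff {U : Set K.Realization} :
    IsOpen U ↔ ∀ s ∈ K, IsOpen ((fun x : ClosedSimplex K s => x.1) ⁻¹' U) :=
  isOpen_iSup_iff.trans ⟨fun h s hs => h ⟨s, hs⟩, fun h s => h s.1 s.2⟩

theorem continuous_coord_closedSimplex (s : Finset V) (v : V) :
    Continuous (fun x : ClosedSimplex K s => x.1.1 v) :=
  (continuous_apply v).comp continuous_induced_dom

theorem continuous_coord (v : V) : Continuous (fun x : K.Realization => x.1 v) :=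
  continuous_iSup_dom.2 fun s => continuous_coinduced_dom.2 (continuous_coord_closedSimplex s.1 v)

theorem coord_eq_zero {x : K.Realization} {τ : Finset V} (h : x.1.support ⊆ τ) {v : V}
    (hv : v ∉ τ) : x.1 v = 0 :=
  Finsupp.notMem_support_iff.1 fun h' => hv (h h')

theorem sum_coord (x : K.Realization) {τ : Finset V} (h : x.1.support ⊆ τ) :
    ∑ v ∈ τ, x.1 v = 1 := by
  have := x.2.2.1
  rwa [Finsupp.sum_of_support_subset _ h _ (fun _ _ => rfl)] at this

/-- A map into `|K|` whose values are supported in a common finite set is continuous if its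
coordinates are. -/
theorem continuous_of_coord {φ : Y → K.Realization} (τ : Finset V)
    (hτ : ∀ y, (φ y).1.support ⊆ τ) (hc : ∀ v, Continuous fun y => (φ y).1 v) : Continuous φ := by
  classical
  -- The faces inside `τ` give a finite closed cover of `Y`, according to which coordinates vanish;
  -- on each member the map factors through one Euclidean closed simplex.
  let ι := {s : Finset V // s ∈ τ.powerset ∧ s ∈ K}
  have : Finite ι := Set.Finite.to_subtype ((Finset.finite_toSet τ.powerset).subset fun s h => h.1)
  let C : ι → Set Y := fun s => {y | (φ y).1.support ⊆ s.1}
  have hC : ∀ s : ι, C s = ⋂ v ∈ {v | v ∉ s.1}, {y | (φ y).1 v = 0} := by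
    intro s
    ext y
    simp only [C, Set.mem_ofPred_eq, Set.mem_iInter]
    refine ⟨fun h v hv => coord_eq_zero h hv, fun h v hv => ?_⟩
    by_contra hvs
    exact Finsupp.mem_support_iff.1 hv (h v hvs)
  refine (locallyFinite_of_finite C).continuous ?_ ?_ ?_
  · refine Set.eq_univ_of_forall fun y => Set.mem_iUnion.2 ?_
    exact ⟨⟨(φ y).1.support, Finset.mem_powerset.2 (hτ y), (φ y).2.2.2⟩, Finset.Subset.refl _⟩
  · intro s
    rw [hC]
    exact isClosed_biInter fun v _ => isClosed_eq (hc v) continuous_const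
  · intro s
    rw [continuousOn_iff_continuous_domRestrict]
    let ψ : C s → ClosedSimplex K s.1 := fun y => ⟨φ y.1, y.2⟩
    have h : Continuous ψ :=
      continuous_induced_rng.2 (continuous_pi fun v => (hc v).comp continuous_subtype_val)
    exact (continuous_val_closedSimplex s.2.2).comp h

instance : T2Space K.Realization :=
  T2Space.of_injective_continuous (f := fun (x : K.Realization) (v : V) => x.1 v)
    (fun _ _ h => ext_coord fun v => congrFun h v) (continuous_pi continuous_coord)

/-- A closed simplex of `|K|` maps to the realization of any complex containing it. -/
def closedSimplexMap {s : Finset V} (hs : s ∈ M) : C(ClosedSimplex K s, M.Realization) where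
  toFun x := ⟨x.1.1, x.1.2.1, x.1.2.2.1,
    mem_of_subset hs x.2 (nonempty_of_mem x.1.2.2.2)⟩
  continuous_toFun := continuous_of_coord s (fun x => x.2) (continuous_coord_closedSimplex s)

/-- The point of `|K|` with given barycentric weights. -/
noncomputable def ofWeights (K : PreAbstractSimplicialComplex V) (τ : Finset V) (w : V → ℝ)
    (h0 : ∀ v, 0 ≤ w v) (hτ : ∀ v, w v ≠ 0 → v ∈ τ) (hK : ∃ s ∈ K, ∀ v, w v ≠ 0 → v ∈ s)
    (hpos : ∃ v, w v ≠ 0) : K.Realization :=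
  have hS : 0 < ∑ v ∈ τ, w v := by
    obtain ⟨v, hv⟩ := hpos
    exact Finset.sum_pos' (fun v _ => h0 v) ⟨v, hτ v hv, lt_of_le_of_ne (h0 v) hv.symm⟩
  have hsupp : ∀ v, w v / ∑ u ∈ τ, w u ≠ 0 ↔ w v ≠ 0 := fun v => by
    rw [ne_eq, div_eq_zero_iff]; simp [hS.ne']
  ⟨Finsupp.onFinset τ (fun v => w v / ∑ u ∈ τ, w u) (fun v hv => hτ v ((hsupp v).1 hv)), by
    refine ⟨fun v => div_nonneg (h0 v) hS.le, ?_, ?_⟩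
    · rw [Finsupp.onFinset_sum _ (fun _ => rfl), ← Finset.sum_div, div_self hS.ne']
    · obtain ⟨s, hs, hws⟩ := hK
      obtain ⟨v, hv⟩ := hpos
      refine mem_of_subset hs (fun u hu => hws u ?_) ⟨v, ?_⟩
      · simpa [hsupp] using hu
      · simpa [hsupp] using hv⟩

theorem ofWeights_coord {τ : Finset V} {w : V → ℝ} (h0 hτ hK hpos) (v : V) :
    (ofWeights K τ w h0 hτ hK hpos).1 v = w v / ∑ u ∈ τ, w u := rfl

theorem ofWeights_support {τ : Finset V} {w : V → ℝ} (h0 hτ hK hpos) :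
    (ofWeights K τ w h0 hτ hK hpos).1.support ⊆ τ := by
  intro v hv
  rw [Finsupp.mem_support_iff, ofWeights_coord] at hv
  exact hτ v fun h => hv (by rw [h, zero_div])

theorem support_subset {τ : Finset V} (h : K ≤ simplexComplex τ) (x : K.Realization) :
    x.1.support ⊆ τ := (h x.2.2.2).2

/-- The realization is a continuous image of finitely many standard simplices. With the Hausdorff
property this supplies the local compactness required for the middle space of a gluing diagram. -/
theorem compactSpace {τ : Finset V} (h : K ≤ simplexComplex τ) : CompactSpace K.Realization := by
  classical
  let T := {s : Finset V // s ∈ τ.powerset ∧ s ∈ K}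
  have : Finite T := Set.Finite.to_subtype ((Finset.finite_toSet τ.powerset).subset fun s h => h.1)
  let φ : (Σ s : T, stdSimplex ℝ s.1) → K.Realization := fun y =>
    ofWeights K y.1.1 (fun v => if hv : v ∈ y.1.1 then y.2.1 ⟨v, hv⟩ else 0)
      (fun v => by
        split_ifs with hv
        exacts [y.2.2.1 _, le_rfl])
      (fun v hv => by by_contra h'; simp [h'] at hv)
      ⟨y.1.1, y.1.2.2, fun v hv => by by_contra h'; simp [h'] at hv⟩
      (by
        by_contra! h'
        have h1 := y.2.2.2
        rw [Finset.sum_eq_zero] at h1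
        · exact zero_ne_one h1
        · intro v _
          simpa using h' v.1)
  have hφ : Continuous φ := by
    refine continuous_sigma fun s => ?_
    refine continuous_of_coord s.1 (fun _ => ofWeights_support _ _ _ _) fun v => ?_
    have hw : ∀ v, Continuous fun y : stdSimplex ℝ s.1 =>
        if hv : v ∈ s.1 then y.1 ⟨v, hv⟩ else 0 := by
      intro v
      split_ifs with hv
      · exact (continuous_apply _).comp continuous_subtype_val
      · exact continuous_const
    simp only [φ, ofWeights_coord]
    refine (hw v).div (continuous_finsetSum _ fun v _ => hw v) fun y => ?_
    rw [← Finset.sum_attach]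
    simp only [Finset.coe_mem, dite_true]
    have := y.2.2
    rw [Finset.univ_eq_attach] at this
    rw [this]
    exact one_ne_zero
  refine Function.Surjective.compactSpace (f := φ) hφ ?_
  intro x
  have hx : ∑ v : x.1.support, x.1 v = 1 := by
    rw [Finset.univ_eq_attach, Finset.sum_attach _ (fun v => x.1 v)]
    exact sum_coord x subset_rfl
  refine ⟨⟨⟨x.1.support, Finset.mem_powerset.2 (support_subset h x), x.2.2.2⟩,
    ⟨fun v => x.1 v, fun v => x.2.1 v, hx⟩⟩, ext_coord fun v => ?_⟩
  simp only [φ, ofWeights_coord]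
  have : ∑ u ∈ x.1.support, (if u ∈ x.1.support then x.1 u else 0) = 1 := by
    refine Eq.trans ?_ (sum_coord x subset_rfl)
    exact Finset.sum_congr rfl fun u hu => if_pos hu
  simp only [dite_eq_ite]
  rw [this]
  by_cases hv : v ∈ x.1.support
  · simp [hv]
  · rw [if_neg hv, Finsupp.notMem_support_iff.1 hv]; simp

/-- Straight-line contraction to a vertex. -/
theorem contractibleSpace_simplexComplex {τ : Finset V} (hτ : τ.Nonempty) :
    ContractibleSpace (simplexComplex τ).Realization := by
  classical
  obtain ⟨v₀, hv₀⟩ := hτ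
  rw [contractible_iff_id_nullhomotopic]
  let e : V → ℝ := fun v => if v = v₀ then 1 else 0
  let w : I × (simplexComplex τ).Realization → V → ℝ := fun y v =>
    (1 - (y.1 : ℝ)) * y.2.1 v + y.1 * e v
  have he : ∑ v ∈ τ, e v = 1 := by simp [e, hv₀]
  have h0 : ∀ y v, 0 ≤ w y v := fun y v => by
    have h1 := y.1.2.1
    have h2 : 0 ≤ 1 - (y.1 : ℝ) := by linarith [y.1.2.2]
    have h3 := y.2.2.1 v
    have h4 : 0 ≤ e v := by simp only [e]; split_ifs <;> norm_num
    simp only [w]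
    positivity
  have hτ' : ∀ y v, w y v ≠ 0 → v ∈ τ := fun y v => by
    contrapose!
    intro hv
    have : v ≠ v₀ := fun h => hv (h ▸ hv₀)
    simp [w, e, coord_eq_zero (support_subset le_rfl y.2) hv, this]
  have hsum : ∀ y, ∑ v ∈ τ, w y v = 1 := fun y => by
    simp only [w, Finset.sum_add_distrib, ← Finset.mul_sum, he]
    rw [sum_coord y.2 (support_subset le_rfl y.2)]; ring
  have hpos : ∀ y, ∃ v, w y v ≠ 0 := fun y => by
    by_contra! h
    have := hsum y
    simp [h] at this
  let Φ : I × (simplexComplex τ).Realization → (simplexComplex τ).Realization := fun y =>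
    ofWeights _ τ (w y) (h0 y) (hτ' y) ⟨τ, ⟨⟨v₀, hv₀⟩, subset_rfl⟩, hτ' y⟩ (hpos y)
  have hΦ' : ∀ y v, (Φ y).1 v = w y v := fun y v => by
    simp only [Φ, ofWeights_coord, hsum, div_one]
  have hΦ : Continuous Φ := by
    refine continuous_of_coord τ (fun _ => ofWeights_support _ _ _ _) fun v => ?_
    simp only [hΦ', w]
    have := (continuous_coord (K := simplexComplex τ) v)
    fun_prop
  let x₀ : (simplexComplex τ).Realization :=
    ofWeights _ τ e (fun v => by simp only [e]; split_ifs <;> norm_num)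
      (fun v hv => by by_cases h : v = v₀ <;> simp_all [e])
      ⟨τ, ⟨⟨v₀, hv₀⟩, subset_rfl⟩, fun v hv => by by_cases h : v = v₀ <;> simp_all [e]⟩
      ⟨v₀, by simp [e]⟩
  refine ⟨x₀, ⟨⟨⟨Φ, hΦ⟩, fun x => ext_coord fun v => ?_, fun x => ext_coord fun v => ?_⟩⟩⟩
  · exact (hΦ' _ _).trans (by simp [w])
  · exact (hΦ' _ _).trans (by simp [w, x₀, ofWeights_coord, he])

end Realization

end PreAbstractSimplicialComplex

/-! ### Homotopy extension for subcomplexes of a simplex. -/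

namespace PreAbstractSimplicialComplex

variable {V : Type*} {K M : PreAbstractSimplicialComplex V}

namespace Realization

open Classical in
/-- The smallest of the values of `x` on `F`, and `0` if `F` is empty. -/
noncomputable def minOn (F : Finset V) (x : V → ℝ) : ℝ :=
  if h : F.Nonempty then F.inf' h x else 0

theorem continuous_minOn (F : Finset V) : Continuous fun x : V → ℝ => minOn F x := by
  unfold minOn
  split_ifs with h
  · exact Continuous.finset_inf'_apply h fun v _ => continuous_apply v
  · exact continuous_const

theorem minOn_nonneg {F : Finset V} {x : V → ℝ} (hx : ∀ v, 0 ≤ x v) : 0 ≤ minOn F x := by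
  unfold minOn
  split_ifs with h
  · exact (Finset.le_inf'_iff h x).2 fun v _ => hx v
  · exact le_rfl

theorem lt_minOn {F : Finset V} {x : V → ℝ} {c : ℝ} (hF : F.Nonempty) (hx : ∀ v ∈ F, c < x v) :
    c < minOn F x := by
  rw [minOn, dif_pos hF]
  exact (Finset.lt_inf'_iff hF).2 hx

theorem minOn_eq_zero {F : Finset V} {x : V → ℝ} (hx : ∀ v, 0 ≤ x v) {v : V} (hv : v ∈ F)
    (h0 : x v = 0) : minOn F x = 0 := by
  refine le_antisymm ?_ (minOn_nonneg hx)
  rw [minOn, dif_pos ⟨v, hv⟩, ← h0]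
  exact Finset.inf'_le x hv

variable (τ : Finset V) (A : PreAbstractSimplicialComplex V)

open Classical in
/-- A function on the simplex spanned by `τ` that vanishes exactly on the subcomplex `A`: the sum
over the non-faces of `A` of the smallest barycentric coordinate. -/
noncomputable def depth (x : V → ℝ) : ℝ :=
  ∑ F ∈ τ.powerset with F ∉ A, minOn F x

theorem continuous_depth : Continuous (depth τ A) :=
  continuous_finsetSum _ fun F _ => continuous_minOn F

variable {τ A}

theorem depth_nonneg {x : V → ℝ} (hx : ∀ v, 0 ≤ x v) : 0 ≤ depth τ A x :=
  Finset.sum_nonneg fun _ _ => minOn_nonneg hx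

theorem depth_eq_zero (x : A.Realization) : depth τ A x.1 = 0 := by
  classical
  refine Finset.sum_eq_zero fun F hF => ?_
  rw [Finset.mem_filter] at hF
  rcases F.eq_empty_or_nonempty with rfl | hne
  · simp [minOn]
  · by_cases h : F ⊆ x.1.support
    · exact absurd (mem_of_subset x.2.2.2 h hne) hF.2
    · obtain ⟨v, hv, hv'⟩ := Finset.not_subset.1 h
      exact minOn_eq_zero x.2.1 hv (Finsupp.notMem_support_iff.1 hv')

/-- A non-face would contribute its smallest coordinate to the depth. So subtracting the depth from
all coordinates and truncating at 0 leaves a support in `A`, provided it is nonempty. -/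
theorem mem_of_depth_lt {x : V → ℝ} (hx : ∀ v, 0 ≤ x v) {F : Finset V} (hF : F ⊆ τ)
    (hne : F.Nonempty) (h : ∀ v ∈ F, depth τ A x < x v) : F ∈ A := by
  classical
  by_contra hA
  have h1 := lt_minOn hne h
  have h2 : minOn F x ≤ depth τ A x := Finset.single_le_sum
    (f := fun F => minOn F x) (fun _ _ => minOn_nonneg hx)
    (Finset.mem_filter.2 ⟨Finset.mem_powerset.2 hF, hA⟩)
  exact absurd h1 h2.not_gt

/-- A subcomplex of a simplex has the homotopy extension property. -/
theorem exists_homotopy_extension {Z : Type*} [TopologicalSpace Z] (hA : A ≤ simplexComplex τ)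
    (F : C(A.Realization × I, Z)) (z : C((simplexComplex τ).Realization, Z))
    (hFz : ∀ a, F (a, 0) = z (inclusion hA a)) :
    ∃ G : C((simplexComplex τ).Realization × I, Z), (∀ x, G (x, 0) = z x) ∧
      ∀ a t, G (inclusion hA a, t) = F (a, t) := by
  classical
  rcases τ.eq_empty_or_nonempty with rfl | hτ
  · have : IsEmpty (simplexComplex (∅ : Finset V)).Realization :=
      ⟨fun x => by
        have h := x.2.2.2
        exact h.1.ne_empty (Finset.subset_empty.1 h.2)⟩
    exact ⟨⟨fun x => isEmptyElim x.1, continuous_of_const fun x => isEmptyElim x.1⟩,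
      fun x => isEmptyElim x, fun a => isEmptyElim (inclusion hA a)⟩
  set Δ := (simplexComplex τ).Realization with hΔ
  have hn : (0 : ℝ) < τ.card := by exact_mod_cast hτ.card_pos
  -- Some barycentric coordinate is at least 1 / card, while at most 1 / c, half of that, is ever
  -- subtracted; so the truncated weights never all vanish.
  let c : ℝ := 2 * τ.card
  have hc : 0 < c := by positivity
  let D : Δ × I → ℝ := fun y => depth τ A y.1.1
  have hcoord : ∀ v, Continuous fun y : Δ × I => y.1.1 v := fun v =>
    (continuous_coord v).comp continuous_fst
  have hD : Continuous D := (continuous_depth τ A).comp (continuous_pi hcoord)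
  have hD0 : ∀ y, 0 ≤ D y := fun y => depth_nonneg y.1.2.1
  let m : Δ × I → ℝ := fun y => min (D y) (y.2 / c)
  have hm : Continuous m := hD.min (by fun_prop)
  have hm0 : ∀ y, 0 ≤ m y := fun y => le_min (hD0 y) (div_nonneg y.2.2.1 hc.le)
  let w : Δ × I → V → ℝ := fun y v => max (y.1.1 v - m y) 0
  have hw : ∀ v, Continuous fun y => w y v := fun v => ((hcoord v).sub hm).max continuous_const
  have hw0 : ∀ y v, 0 ≤ w y v := fun y v => le_max_right _ _
  have hwne : ∀ y v, w y v ≠ 0 ↔ m y < y.1.1 v := fun y v => by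
    simp only [w]
    constructor
    · intro h
      by_contra h'
      exact h (max_eq_right (by linarith))
    · intro h
      rw [max_eq_left (by linarith)]
      linarith
  have hsub : ∀ y v, w y v ≠ 0 → v ∈ y.1.1.support := fun y v h =>
    Finsupp.mem_support_iff.2 ((hm0 y).trans_lt ((hwne y v).1 h)).ne'
  have hτs : ∀ y v, w y v ≠ 0 → v ∈ τ := fun y v h => support_subset le_rfl y.1 (hsub y v h)
  have hpos : ∀ y, ∃ v, w y v ≠ 0 := fun y => by
    simp only [hwne]
    by_contra! h
    have h1 := sum_coord y.1 (support_subset le_rfl y.1)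
    have h2 : m y ≤ 1 / c := (min_le_right _ _).trans (div_le_div_of_nonneg_right y.2.2.2 hc.le)
    have h3 : ∑ v ∈ τ, y.1.1 v ≤ τ.card • (1 / c) :=
      Finset.sum_le_card_nsmul _ _ _ fun v _ => (h v).trans h2
    rw [h1, nsmul_eq_mul] at h3
    have h4 : (τ.card : ℝ) * (1 / c) = 1 / 2 := by simp only [c]; field_simp
    rw [h4] at h3
    norm_num at h3
  have hsumne : ∀ y, ∑ v ∈ τ, w y v ≠ 0 := fun y => by
    obtain ⟨v, hv⟩ := hpos y
    exact (Finset.sum_pos' (fun v _ => hw0 y v)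
      ⟨v, hτs y v hv, lt_of_le_of_ne (hw0 y v) hv.symm⟩).ne'
  have hwc : ∀ v, Continuous fun y => w y v / ∑ u ∈ τ, w y u := fun v =>
    (hw v).div (continuous_finsetSum _ fun u _ => hw u) hsumne
  let R : Δ × I → Δ := fun y => ofWeights _ τ (w y) (hw0 y) (hτs y)
    ⟨_, y.1.2.2.2, hsub y⟩ (hpos y)
  have hR : Continuous R :=
    continuous_of_coord τ (fun _ => ofWeights_support _ _ _ _) hwc
  have hRm : ∀ y, m y = 0 → R y = y.1 := fun y hy => ext_coord fun v => by
    have h : ∀ v, w y v = y.1.1 v := fun v => by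
      simp only [w, hy, sub_zero]
      exact max_eq_left (y.1.2.1 v)
    simp only [R, ofWeights_coord, h]
    rw [sum_coord y.1 (support_subset le_rfl y.1), div_one]
  -- Near `A` (in `C₁`) the full depth is subtracted and the point lands in `A`, where `F` applies;
  -- far from `A` (in `C₂`) only t / c is subtracted and `z` applies.
  let C₁ : Set (Δ × I) := {y | D y ≤ y.2 / c}
  let C₂ : Set (Δ × I) := {y | y.2 / c ≤ D y}
  have hC₁ : IsClosed C₁ := isClosed_le hD (by fun_prop)
  have hC₂ : IsClosed C₂ := isClosed_le (by fun_prop) hD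
  have hface : ∀ y ∈ C₁, ∃ s ∈ A, ∀ v, w y v ≠ 0 → v ∈ s := fun y hy => by
    have hmy : m y = D y := min_eq_left hy
    refine ⟨τ.filter fun v => w y v ≠ 0, ?_, fun v hv => Finset.mem_filter.2 ⟨hτs y v hv, hv⟩⟩
    obtain ⟨v, hv⟩ := hpos y
    refine mem_of_depth_lt y.1.2.1 (Finset.filter_subset _ _)
      ⟨v, Finset.mem_filter.2 ⟨hτs y v hv, hv⟩⟩ fun u hu => ?_
    have := (hwne y u).1 (Finset.mem_filter.1 hu).2
    rwa [hmy] at this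
  let RA : C₁ → A.Realization := fun y => ofWeights _ τ (w y.1) (hw0 y) (hτs y)
    (hface y.1 y.2) (hpos y)
  have hRA : Continuous RA := continuous_of_coord τ (fun _ => ofWeights_support _ _ _ _)
    fun v => (hwc v).comp continuous_subtype_val
  have hRAR : ∀ y, inclusion hA (RA y) = R y.1 := fun y => ext_coord fun v => rfl
  -- The remaining time: t itself on `A`, and 0 on the interface D = t / c, where `hFz` makes the
  -- two formulas agree.
  let s' : Δ × I → I := fun y => Set.projIcc 0 1 zero_le_one (y.2 - c * D y)
  have hs' : Continuous s' := continuous_projIcc.comp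
    ((continuous_subtype_val.comp continuous_snd).sub (continuous_const.mul hD))
  let G : Δ × I → Z := fun y => if h : y ∈ C₁ then F (RA ⟨y, h⟩, s' y) else z (R y)
  have hG₁ : ∀ y (h : y ∈ C₁), G y = F (RA ⟨y, h⟩, s' y) := fun y h => dif_pos h
  have hG₂ : ∀ y ∈ C₂, G y = z (R y) := fun y h => by
    by_cases h' : y ∈ C₁
    · have hs0 : s' y = 0 := by
        refine Set.projIcc_of_le_left _ ?_
        have : y.2 / c = D y := le_antisymm h h'
        rw [← this, mul_div_cancel₀ _ hc.ne', sub_self]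
      rw [hG₁ y h', hs0, hFz, hRAR]
    · exact dif_neg h'
  have hGc : Continuous G := by
    rw [← continuousOn_univ, ← show C₁ ∪ C₂ = Set.univ from
      Set.eq_univ_of_forall fun y => le_total (D y) (y.2 / c)]
    refine ContinuousOn.union_of_isClosed ?_ ?_ hC₁ hC₂
    · rw [continuousOn_iff_continuous_domRestrict]
      have : Continuous fun y : C₁ => F (RA y, s' y.1) :=
        (map_continuous F).comp (hRA.prodMk (hs'.comp continuous_subtype_val))
      exact this.congr fun y => (hG₁ y.1 y.2).symm
    · exact (z.continuous.comp hR).continuousOn.congr hG₂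
  refine ⟨⟨G, hGc⟩, fun x => ?_, fun a t => ?_⟩
  · have h2 : ((x, 0) : Δ × I) ∈ C₂ := by
      change ((0 : I) : ℝ) / c ≤ D (x, 0)
      simpa using hD0 (x, 0)
    refine (hG₂ _ h2).trans ?_
    rw [hRm]
    refine le_antisymm ((min_le_right _ _).trans ?_) (hm0 _)
    simp
  · have hDa : D (inclusion hA a, t) = 0 := depth_eq_zero a
    have h1 : ((inclusion hA a, t) : Δ × I) ∈ C₁ := by
      change D (inclusion hA a, t) ≤ (t : ℝ) / c
      rw [hDa]
      exact div_nonneg t.2.1 hc.le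
    refine (hG₁ _ h1).trans ?_
    have e1 : RA ⟨_, h1⟩ = a := by
      refine inclusion_injective hA ?_
      rw [hRAR, hRm]
      exact le_antisymm ((min_le_left _ _).trans hDa.le) (hm0 _)
    have e2 : s' (inclusion hA a, t) = t := by
      simp only [s', hDa, mul_zero, sub_zero]
      exact Set.projIcc_val _ t
    rw [e1, e2]

/-! ### Gluing simplices to a subcomplex. -/

section Pushout

variable {ι : Type*} (ρ : ι → Finset V)

/-- The intersections of the simplices `ρ i` with the subcomplex `M`, included in `M`. -/
def gluingLeft (M : PreAbstractSimplicialComplex V) :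
    C(Σ i, (simplexComplex (ρ i) ⊓ M).Realization, M.Realization) :=
  ContinuousMap.sigma fun _ => inclusion inf_le_right

/-- The intersections of the simplices `ρ i` with the subcomplex `M`, included in the simplices. -/
def gluingRight (M : PreAbstractSimplicialComplex V) :
    C(Σ i, (simplexComplex (ρ i) ⊓ M).Realization, Σ i, (simplexComplex (ρ i)).Realization) :=
  ContinuousMap.sigma fun i => (ContinuousMap.sigmaMk i).comp (inclusion inf_le_left)

variable {ρ}

/-- If `K` is covered by a subcomplex `M` and simplices any two of which meet inside `M`, then `|K|`
is the double mapping cylinder of the diagram gluing the simplices to `|M|`. -/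
theorem nonempty_homotopyEquiv_gluing (hM : M ≤ K) (hρ : ∀ i, simplexComplex (ρ i) ≤ K)
    (hcover : ∀ s ∈ K, s ∈ M ∨ ∃ i, s ⊆ ρ i)
    (hdisj : ∀ i i', i ≠ i' → simplexComplex (ρ i) ⊓ simplexComplex (ρ i') ≤ M) :
    Nonempty (DoubleCylinder (gluingLeft ρ M) (gluingRight ρ M) ≃ₕ K.Realization) := by
  let j : C(Σ i, (simplexComplex (ρ i)).Realization, K.Realization) :=
    ContinuousMap.sigma fun i => inclusion (hρ i)
  have hext : ∀ i, ∃ G : C((simplexComplex (ρ i)).Realization × I,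
      DoubleCylinder (gluingLeft ρ M) (gluingRight ρ M)),
      (∀ x, G (x, 0) = DoubleCylinder.inr _ _ ⟨i, x⟩) ∧
      ∀ (a : (simplexComplex (ρ i) ⊓ M).Realization) t, G (inclusion inf_le_left a, t) =
        DoubleCylinder.seg _ _ (⟨i, a⟩, σ t) := by
    intro i
    refine exists_homotopy_extension inf_le_left
      ((DoubleCylinder.seg (gluingLeft ρ M) (gluingRight ρ M)).comp
        ((ContinuousMap.sigmaMk
          (X := fun i => (simplexComplex (ρ i) ⊓ M).Realization) i).prodMap ⟨σ, by fun_prop⟩))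
      ((DoubleCylinder.inr (gluingLeft ρ M) (gluingRight ρ M)).comp
        (ContinuousMap.sigmaMk (X := fun i => (simplexComplex (ρ i)).Realization) i)) ?_
    intro a
    change DoubleCylinder.seg _ _ (_, σ 0) = _
    rw [unitInterval.symm_zero]
    exact DoubleCylinder.seg_one _ _ _
  choose G hG0 hG using hext
  let Γ : C(Σ i, (simplexComplex (ρ i)).Realization,
      C(I, DoubleCylinder (gluingLeft ρ M) (gluingRight ρ M))) :=
    ContinuousMap.sigma fun i => (G i).curry
  refine DoubleCylinder.nonempty_homotopyEquiv_pushout (inclusion hM) j ?_ ?_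
    (inclusion_injective hM) ?_ ?_ (ContinuousMap.uncurry Γ) ?_ ?_
  · rintro ⟨i, a⟩
    rfl
  -- Closed simplices determine the topology of |K|, and each lifts continuously to |M| or to one
  -- glued simplex; this makes the map a quotient map.
  · have hlift : ∀ s ∈ K, ∃ φ : C(ClosedSimplex K s,
        M.Realization ⊕ Σ i, (simplexComplex (ρ i)).Realization),
        ∀ x, Sum.elim (inclusion hM) j (φ x) = x.1 := by
      intro s hs
      rcases hcover s hs with h | ⟨i, hi⟩
      · exact ⟨⟨fun x => Sum.inl (closedSimplexMap h x), by fun_prop⟩, fun x => rfl⟩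
      · have h : s ∈ simplexComplex (ρ i) := ⟨nonempty_of_mem hs, hi⟩
        exact ⟨⟨fun x => Sum.inr ⟨i, closedSimplexMap h x⟩,
          continuous_inr.comp (continuous_sigmaMk.comp (map_continuous _))⟩, fun x => rfl⟩
    have hsurj : Function.Surjective (Sum.elim (inclusion hM) j) := fun x => by
      obtain ⟨φ, hφ⟩ := hlift _ x.2.2.2
      exact ⟨_, hφ ⟨x, Finset.Subset.refl _⟩⟩
    refine (Topology.isQuotientMap_iff _).2 ⟨Topology.isCoinducing_iff.2 fun U =>
      ⟨fun h => ?_, fun h => h.preimage (by fun_prop)⟩, hsurj⟩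
    · rw [isOpen_iff]
      intro s hs
      obtain ⟨φ, hφ⟩ := hlift s hs
      convert h.preimage φ.continuous using 1
      ext x
      simp only [Set.mem_preimage, hφ]
  · rintro ⟨i, p⟩ x h
    have hc : p.1 = x.1 := congrArg (fun y : K.Realization => y.1) h
    refine ⟨⟨i, ⟨p.1, p.2.1, p.2.2.1, p.2.2.2, ?_⟩⟩, ?_, ?_⟩
    · exact hc ▸ x.2.2.2
    · rfl
    · exact ext_coord fun v => congrArg (fun y : V →₀ ℝ => y v) hc
  · rintro ⟨i, p⟩ ⟨i', p'⟩ h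
    have hc : p.1 = p'.1 := congrArg (fun y : K.Realization => y.1) h
    by_cases hii : i = i'
    · subst hii
      exact Or.inl (congrArg _ (ext_coord fun v => congrArg (fun y : V →₀ ℝ => y v) hc))
    · have hm : p.1.support ∈ M := hdisj i i' hii ⟨p.2.2.2, hc ▸ p'.2.2.2⟩
      exact Or.inr ⟨⟨i, ⟨p.1, p.2.1, p.2.2.1, p.2.2.2, hm⟩⟩,
        ⟨i', ⟨p'.1, p'.2.1, p'.2.2.1, p'.2.2.2, hc ▸ hm⟩⟩, rfl, rfl,
        ext_coord fun v => congrArg (fun y : V →₀ ℝ => y v) hc⟩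
  · rintro ⟨i, p⟩
    exact hG0 i p
  · rintro ⟨i, a⟩ t
    exact hG i a t

end Pushout

/-- A connected realization is path connected. -/
theorem joined_of_connectedSpace [ConnectedSpace K.Realization] (x y : K.Realization) :
    Joined x y := by
  classical
  have hseg : ∀ (s : Finset V), s ∈ K → ∀ u v : ClosedSimplex K s, Joined u.1 v.1 := by
    intro s hs u v
    have := contractibleSpace_simplexComplex (nonempty_of_mem hs)
    have hsK : simplexComplex s ≤ K := fun t ht => mem_of_subset hs ht.2 ht.1
    have hs' : s ∈ simplexComplex s := ⟨nonempty_of_mem hs, subset_rfl⟩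
    obtain ⟨p⟩ := PathConnectedSpace.joined (closedSimplexMap hs' u) (closedSimplexMap hs' v)
    exact ⟨p.map (inclusion hsK).continuous⟩
  -- A closed simplex lies entirely inside or entirely outside a path component.
  have hopen : ∀ x : K.Realization, IsOpen {y | Joined x y} := by
    intro x
    rw [isOpen_iff]
    intro s hs
    by_cases h : ∃ u : ClosedSimplex K s, Joined x u.1
    · obtain ⟨u, hu⟩ := h
      convert isOpen_univ
      exact Set.eq_univ_of_forall fun v => hu.trans (hseg s hs u v)
    · convert isOpen_empty
      exact Set.eq_empty_of_forall_notMem fun v hv => h ⟨v, hv⟩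
  have hclopen : IsClopen {y | Joined x y} := by
    refine ⟨⟨?_⟩, hopen x⟩
    rw [isOpen_iff_forall_mem_open]
    refine fun z hz => ⟨_, fun t (ht : Joined z t) h => hz (Joined.trans h ht.symm), hopen z,
      Joined.refl z⟩
  have := hclopen.eq_univ ⟨x, Joined.refl x⟩
  exact (Set.eq_univ_iff_forall.1 this) y

end Realization

end PreAbstractSimplicialComplex

/-! ### Spheres as suspensions. -/

namespace UnitSphere

theorem sum_sq {n : ℕ} (y : UnitSphere n) : ∑ i, y.1 i ^ 2 = 1 := by
  have h := EuclideanSpace.norm_sq_eq y.1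
  rw [norm_eq_of_mem_sphere y] at h
  simpa using h.symm

theorem ext_coord {n : ℕ} {y z : UnitSphere n} (h : ∀ i, y.1 i = z.1 i) : y = z :=
  Subtype.ext (PiLp.ext h)

/-- The point of the sphere with given coordinates. -/
def ofCoord {n : ℕ} (x : Fin (n + 1) → ℝ) (h : ∑ i, x i ^ 2 = 1) : UnitSphere n :=
  ⟨WithLp.toLp 2 x, by
    rw [mem_sphere_zero_iff_norm, EuclideanSpace.norm_eq]
    simp [h]⟩

@[simp] theorem ofCoord_coord {n : ℕ} (x : Fin (n + 1) → ℝ) (h : ∑ i, x i ^ 2 = 1) (i) :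
    (ofCoord x h).1 i = x i := rfl

/-- The parametrization of `Sⁿ⁺¹` as the unreduced suspension of `Sⁿ`. -/
noncomputable def suspension (n : ℕ) : C(UnitSphere n × I, UnitSphere (n + 1)) where
  toFun y := ofCoord (Fin.cons (Real.cos (Real.pi * y.2)) fun i => Real.sin (Real.pi * y.2) * y.1.1 i)
    (by
      rw [Fin.sum_univ_succ]
      simp only [Fin.cons_zero, Fin.cons_succ, mul_pow]
      rw [← Finset.mul_sum, sum_sq, mul_one, Real.cos_sq_add_sin_sq])
  continuous_toFun := by
    refine Continuous.subtype_mk ((PiLp.continuous_toLp 2 _).comp (continuous_pi fun i => ?_)) _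
    refine Fin.cases ?_ (fun i => ?_) i
    · simp only [Fin.cons_zero]; fun_prop
    · simp only [Fin.cons_succ]; fun_prop

variable {n : ℕ}

theorem suspension_coord_zero (y : UnitSphere n) (t : I) :
    (suspension n (y, t)).1 0 = Real.cos (Real.pi * t) := rfl

theorem suspension_coord_succ (y : UnitSphere n) (t : I) (i : Fin (n + 1)) :
    (suspension n (y, t)).1 i.succ = Real.sin (Real.pi * t) * y.1 i := rfl

theorem suspension_zero (y : UnitSphere n) : suspension n (y, 0) = base (n + 1) :=
  ext_coord fun i => by
    refine Fin.cases ?_ (fun i => ?_) i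
    · rw [suspension_coord_zero]; simp [base]
    · rw [suspension_coord_succ]; simp [base]

/-- The cosine is injective on [0, π], so the first coordinate determines t; off the poles the sine
is nonzero and can be cancelled. -/
theorem suspension_eq {y y' : UnitSphere n} {t t' : I}
    (h : suspension n (y, t) = suspension n (y', t')) :
    t = t' ∧ (t = 0 ∨ t = 1 ∨ y = y') := by
  have hπ := Real.pi_pos
  have h0 : Real.cos (Real.pi * t) = Real.cos (Real.pi * t') := by
    rw [← suspension_coord_zero y, h, suspension_coord_zero]
  have hmem : ∀ t : I, Real.pi * t ∈ Set.Icc 0 Real.pi := fun t =>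
    ⟨mul_nonneg hπ.le t.2.1, by nlinarith [t.2.2]⟩
  have ht : t = t' := Subtype.ext
    (mul_left_cancel₀ hπ.ne' (Real.injOn_cos (hmem t) (hmem t') h0))
  subst ht
  refine ⟨rfl, ?_⟩
  by_contra! hne
  obtain ⟨h1, h2, h3⟩ := hne
  have hs : 0 < Real.sin (Real.pi * t) := by
    have ht0 : (0 : ℝ) < t := lt_of_le_of_ne t.2.1 fun h => h1 (Subtype.ext h.symm)
    have ht1 : (t : ℝ) < 1 := lt_of_le_of_ne t.2.2 fun h => h2 (Subtype.ext h)
    exact Real.sin_pos_of_pos_of_lt_pi (mul_pos hπ ht0) (by nlinarith)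
  refine h3 (ext_coord fun i => mul_left_cancel₀ hs.ne' ?_)
  rw [← suspension_coord_succ, ← suspension_coord_succ, h]

theorem suspension_surjective : Function.Surjective (suspension n) := by
  intro z
  have hz : z.1 0 ^ 2 + ∑ i : Fin (n + 1), z.1 i.succ ^ 2 = 1 := by
    rw [← Fin.sum_univ_succ (fun i => z.1 i ^ 2), sum_sq]
  have hS0 : 0 ≤ ∑ i : Fin (n + 1), z.1 i.succ ^ 2 := Finset.sum_nonneg fun i _ => sq_nonneg _
  have hz1 : -1 ≤ z.1 0 := by nlinarith
  have hz2 : z.1 0 ≤ 1 := by nlinarith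
  have hπ := Real.pi_pos
  let t : I := ⟨Real.arccos (z.1 0) / Real.pi, div_nonneg (Real.arccos_nonneg _) hπ.le,
    (div_le_one hπ).2 (Real.arccos_le_pi _)⟩
  have ht : Real.pi * (t : ℝ) = Real.arccos (z.1 0) := mul_div_cancel₀ _ hπ.ne'
  have hcos : Real.cos (Real.pi * t) = z.1 0 := by rw [ht, Real.cos_arccos hz1 hz2]
  have hsin : Real.sin (Real.pi * t) ^ 2 = ∑ i : Fin (n + 1), z.1 i.succ ^ 2 := by
    have := Real.cos_sq_add_sin_sq (Real.pi * t)
    rw [hcos] at this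
    linarith
  by_cases hs : Real.sin (Real.pi * t) = 0
  · refine ⟨(base n, t), ext_coord fun i => ?_⟩
    refine Fin.cases hcos (fun i => ?_) i
    rw [suspension_coord_succ, hs, zero_mul]
    rw [hs, zero_pow two_ne_zero] at hsin
    have := (Finset.sum_eq_zero_iff_of_nonneg fun i _ => sq_nonneg _).1 hsin.symm i
      (Finset.mem_univ i)
    exact (pow_eq_zero_iff two_ne_zero).1 this |>.symm
  · refine ⟨(ofCoord (fun i => z.1 i.succ / Real.sin (Real.pi * t)) ?_, t), ext_coord fun i => ?_⟩
    · simp only [div_pow]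
      rw [← Finset.sum_div, ← hsin, div_self (pow_ne_zero 2 hs)]
    · refine Fin.cases hcos (fun i => ?_) i
      rw [suspension_coord_succ, ofCoord_coord, mul_div_cancel₀ _ hs]

theorem isQuotientMap_suspension : Topology.IsQuotientMap (suspension n) :=
  Topology.IsQuotientMap.of_surjective_continuous suspension_surjective (map_continuous _)

end UnitSphere

/-! ### The model diagram with constant attaching maps. -/

section Wedge

/-- The spaces `pt` (`a` times) and `Sᵈ` (`b` times). -/
def pointsAndSpheres (a b d : ℕ) : Fin a ⊕ Fin b → TopCat.{0} :=
  Sum.elim (fun _ => TopCat.of PUnit) fun _ => TopCat.of (UnitSphere d)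

/-- A point of each of the spaces `pointsAndSpheres`. -/
noncomputable def pointsAndSpheresBase (a b d : ℕ) : ∀ i, pointsAndSpheres a b d i
  | Sum.inl _ => PUnit.unit
  | Sum.inr _ => UnitSphere.base d

variable {X : Type*} [TopologicalSpace X] {a b : ℕ} (d : ℕ) (p : Fin a ⊕ Fin b → X)

/-- The map from a disjoint union of points and spheres that is constant on each of them. -/
def piecewiseConst : C(Σ i, pointsAndSpheres a b d i, X) :=
  ContinuousMap.sigma fun i => ContinuousMap.const _ (p i)

/-- The map sending a point of a disjoint union of points and spheres to the index of its piece. -/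
def pieceIndex (a b d : ℕ) : C(Σ i, pointsAndSpheres a b d i, Fin a ⊕ Fin b) :=
  ContinuousMap.sigma fun i => ContinuousMap.const _ i

/-- Attaching arcs and cones over spheres by constant maps yields spheres glued at points, up to
homotopy equivalence. -/
theorem nonempty_homotopyEquiv_wedgeSpheres :
    Nonempty (DoubleCylinder (piecewiseConst d p) (pieceIndex a b d) ≃ₕ
      WedgeSpheres (d + 1) fun j => p (Sum.inr j)) := by
  let W := WedgeSpheres (d + 1) fun j => p (Sum.inr j)
  let D := DoubleCylinder (piecewiseConst d p) (pieceIndex a b d)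
  let sg : C((Σ i, pointsAndSpheres a b d i) × I, D) := DoubleCylinder.seg _ _
  have hz : ∀ i y, sg (⟨i, y⟩, 0) = DoubleCylinder.inl _ _ (p i) := fun _ _ =>
    DoubleCylinder.seg_zero _ _ _
  have ho : ∀ i y, sg (⟨i, y⟩, 1) = DoubleCylinder.inr _ _ i := fun _ _ =>
    DoubleCylinder.seg_one _ _ _
  let pt := pointsAndSpheresBase a b d
  let wl : C(X, W) := ⟨fun x => Quot.mk _ (Sum.inl x), continuous_quot_mk.comp continuous_inl⟩
  let wr (j : Fin b) : C(UnitSphere (d + 1), W) := ⟨fun x => Quot.mk _ (Sum.inr (j, x)),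
    continuous_quot_mk.comp (continuous_inr.comp (by fun_prop))⟩
  have hglue : ∀ j, wr j (UnitSphere.base (d + 1)) = wl (p (Sum.inr j)) := fun j =>
    (Quot.sound (SphereGluing.glue j)).symm
  -- Arcs collapse to their attaching points; cylinders over spheres become suspensions, the end t =
  -- 0 going to the base point.
  let q₀ : ∀ i, C(pointsAndSpheres a b d i × I, W) := fun i =>
    match i with
    | Sum.inl i => ContinuousMap.const _ (wl (p (Sum.inl i)))
    | Sum.inr j => (wr j).comp (UnitSphere.suspension d)
  let q₁ : C((Σ i, pointsAndSpheres a b d i) × I, W) :=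
    ContinuousMap.uncurry (ContinuousMap.sigma fun i => (q₀ i).curry)
  let w : C(Fin a ⊕ Fin b, W) := ⟨fun i => q₁ (⟨i, pt i⟩, 1), continuous_of_discreteTopology⟩
  have hone : ∀ (j : Fin b) (y y' : UnitSphere d),
      UnitSphere.suspension d (y, 1) = UnitSphere.suspension d (y', 1) := fun j y y' =>
    UnitSphere.ext_coord fun i => by
      refine Fin.cases rfl (fun i => ?_) i
      simp [UnitSphere.suspension_coord_succ]
  let q : C(D, W) := DoubleCylinder.lift wl w q₁
    (by
      rintro ⟨i | j, y⟩
      · rfl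
      · exact (congrArg (wr j) (UnitSphere.suspension_zero y)).trans (hglue j))
    (by
      rintro ⟨i | j, y⟩
      · rfl
      · exact congrArg (wr j) (hone j _ _))
  have hS : ∀ j : Fin b, ∃ S : C(UnitSphere (d + 1), D),
      ∀ y t, S (UnitSphere.suspension d (y, t)) = sg (⟨Sum.inr j, y⟩, t) := by
    intro j
    let r : C(UnitSphere d × I, D) := sg.comp ((ContinuousMap.sigmaMk
      (X := fun i => pointsAndSpheres a b d i) (Sum.inr j)).prodMap (ContinuousMap.id I))
    have hr : Function.FactorsThrough r (UnitSphere.suspension d) := by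
      rintro ⟨y, t⟩ ⟨y', t'⟩ h
      obtain ⟨rfl, rfl | rfl | rfl⟩ := UnitSphere.suspension_eq h
      · exact (hz (Sum.inr j) y).trans (hz (Sum.inr j) y').symm
      · exact (ho (Sum.inr j) y).trans (ho (Sum.inr j) y').symm
      · rfl
    exact ⟨UnitSphere.isQuotientMap_suspension.lift r hr, fun y t => congrArg
      (fun F : C(UnitSphere d × I, D) => F (y, t)) (UnitSphere.isQuotientMap_suspension.lift_comp r hr)⟩
  choose S hS using hS
  let s : C(W, D) :=
    { toFun := Quot.lift (Sum.elim (DoubleCylinder.inl _ _) fun x => S x.1 x.2) (by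
        rintro _ _ ⟨j⟩
        simp only [Sum.elim_inl, Sum.elim_inr]
        rw [← UnitSphere.suspension_zero (UnitSphere.base d), hS]
        exact (hz _ _).symm)
      continuous_toFun := continuous_quot_lift _ (by
        refine Continuous.sumElim (map_continuous _) ?_
        rw [continuous_prod_of_discrete_left]
        exact fun j => map_continuous (S j)) }
  -- Scaling heights by `e` shrinks the arcs to their attaching points as s goes to 0 and leaves the
  -- sphere pieces fixed.
  let e : I × (Fin a ⊕ Fin b) → I := fun x => Sum.elim (fun _ => x.1) (fun _ => 1) x.2
  have he : Continuous e := by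
    rw [continuous_prod_of_discrete_right]
    rintro (i | j)
    · exact continuous_id
    · exact continuous_const
  have hpt : Continuous fun i : Fin a ⊕ Fin b =>
    (⟨i, pt i⟩ : Σ i, pointsAndSpheres a b d i) := continuous_of_discreteTopology
  refine ⟨⟨q, s, ?_, ?_⟩⟩
  · refine DoubleCylinder.homotopic_of
      ((DoubleCylinder.inl _ _).comp ContinuousMap.snd)
      (sg.comp ⟨fun x => (⟨x.2, pt x.2⟩, e x), (hpt.comp continuous_snd).prodMk he⟩)
      (sg.comp ⟨fun x => (x.2.1, e (x.1, pieceIndex a b d x.2.1) * x.2.2), by fun_prop⟩)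
      ?_ ?_ ?_ ?_ ?_ ?_ ?_ ?_
    · rintro s ⟨i, y⟩
      change sg (⟨i, y⟩, e (s, i) * 0) = _
      rw [mul_zero]
      exact hz i y
    · rintro s ⟨i | j, y⟩
      · change sg (⟨Sum.inl i, y⟩, s * 1) = sg (⟨Sum.inl i, y⟩, s)
        rw [mul_one]
      · change sg (⟨Sum.inr j, y⟩, 1 * 1) = sg (⟨Sum.inr j, _⟩, 1)
        rw [mul_one]
        exact (ho _ _).trans (ho _ _).symm
    · intro x; rfl
    · intro x; rfl
    · rintro (i | j)
      · exact (hz _ _).symm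
      · exact hS j _ 1
    · rintro (i | j)
      · exact (ho _ _).symm
      · exact (ho _ _).symm
    · rintro ⟨i | j, y⟩ t
      · change _ = sg (⟨Sum.inl i, y⟩, 0 * t)
        rw [zero_mul]
        exact (hz _ _).symm
      · change _ = sg (⟨Sum.inr j, y⟩, 1 * t)
        rw [one_mul]
        exact hS j y t
    · rintro ⟨i | j, y⟩ t
      · change _ = sg (⟨Sum.inl i, y⟩, 1 * t)
        rw [one_mul]
        rfl
      · change _ = sg (⟨Sum.inr j, y⟩, 1 * t)
        rw [one_mul]
        rfl
  · have hqs : q.comp s = ContinuousMap.id W := by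
      ext z
      rcases z with ⟨x | ⟨j, z⟩⟩
      · rfl
      · obtain ⟨⟨y, t⟩, rfl⟩ := UnitSphere.suspension_surjective z
        change q (S j (UnitSphere.suspension d (y, t))) = wr j (UnitSphere.suspension d (y, t))
        rw [hS]
        rfl
    rw [hqs]

end Wedge

/-! ### Homotopies on disjoint unions. -/

section Sigma

variable {ι : Type*} {X Y : ι → Type*} [∀ i, TopologicalSpace (X i)] [∀ i, TopologicalSpace (Y i)]
  {Z : Type*} [TopologicalSpace Z]

theorem ContinuousMap.Homotopic.of_sigma {φ ψ : C(Σ i, X i, Z)}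
    (h : ∀ i, (φ.comp (ContinuousMap.sigmaMk i)).Homotopic (ψ.comp (ContinuousMap.sigmaMk i))) :
    φ.Homotopic ψ := by
  let K : C(Σ i, X i, C(I, Z)) :=
    ContinuousMap.sigma fun i => ((Classical.choice (h i)).toContinuousMap.comp prodSwap).curry
  refine ⟨⟨(ContinuousMap.uncurry K).comp prodSwap, ?_, ?_⟩⟩
  · rintro ⟨i, x⟩
    exact (Classical.choice (h i)).map_zero_left x
  · rintro ⟨i, x⟩
    exact (Classical.choice (h i)).map_one_left x

/-- The map of disjoint unions induced by a family of maps. -/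
def ContinuousMap.sigmaMap (φ : ∀ i, C(X i, Y i)) : C(Σ i, X i, Σ i, Y i) :=
  ContinuousMap.sigma fun i => (ContinuousMap.sigmaMk i).comp (φ i)

theorem IsHEquiv.sigmaMap {φ : ∀ i, C(X i, Y i)} (h : ∀ i, IsHEquiv (φ i)) :
    IsHEquiv (ContinuousMap.sigmaMap φ) := by
  choose ψ h1 h2 using h
  exact ⟨ContinuousMap.sigmaMap ψ,
    Homotopic.of_sigma fun i => (Homotopic.refl (ContinuousMap.sigmaMk i)).comp (h1 i),
    Homotopic.of_sigma fun i => (Homotopic.refl (ContinuousMap.sigmaMk i)).comp (h2 i)⟩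

/-- A disjoint union of contractible spaces is equivalent to its index set. -/
theorem isHEquiv_sigma_index [TopologicalSpace ι] [DiscreteTopology ι]
    [∀ i, ContractibleSpace (X i)] :
    IsHEquiv (ContinuousMap.sigma fun i => ContinuousMap.const (X i) i) := by
  choose x hx using fun i => id_nullhomotopic (X i)
  refine ⟨⟨fun i => ⟨i, x i⟩, continuous_of_discreteTopology⟩, Homotopic.of_sigma fun i => ?_, ?_⟩
  · exact (Homotopic.refl (ContinuousMap.sigmaMk i)).comp (hx i).symm
  · exact Homotopic.refl _

end Sigma

instance (a b d : ℕ) (i : Fin a ⊕ Fin b) : CompactSpace (pointsAndSpheres a b d i) :=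
  match i with
  | Sum.inl _ => inferInstanceAs (CompactSpace PUnit)
  | Sum.inr _ => inferInstanceAs (CompactSpace (UnitSphere d))

instance (a b d : ℕ) (i : Fin a ⊕ Fin b) : T2Space (pointsAndSpheres a b d i) :=
  match i with
  | Sum.inl _ => inferInstanceAs (T2Space PUnit)
  | Sum.inr _ => inferInstanceAs (T2Space (UnitSphere d))

/-! ### Assembling the proof. -/

namespace PreAbstractSimplicialComplex

open Realization

variable {V : Type*} {K M : PreAbstractSimplicialComplex V}

/-- Gluing finitely many simplices to a complex `M ≃ Y` along contractible subcomplexes and along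
subcomplexes equivalent to `Sᵈ`, null-homotopic in `Y`, amounts to gluing spheres `Sᵈ⁺¹` to `Y`. -/
theorem nonempty_homotopyEquiv_wedgeSpheres {Y : Type*} [TopologicalSpace Y] {a b d : ℕ}
    (ρ : Fin a ⊕ Fin b → Finset V) (hM : M ≤ K) (hρ : ∀ i, ρ i ∈ K)
    (hcover : ∀ s ∈ K, s ∈ M ∨ ∃ i, s ⊆ ρ i)
    (hdisj : ∀ i i', i ≠ i' → simplexComplex (ρ i) ⊓ simplexComplex (ρ i') ≤ M)
    (hB : ∀ i, Nonempty ((simplexComplex (ρ i) ⊓ M).Realization ≃ₕ pointsAndSpheres a b d i))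
    {e : C(M.Realization, Y)} (he : IsHEquiv e) (p : Fin a ⊕ Fin b → Y)
    (hp : ∀ i, (e.comp (inclusion (inf_le_right : simplexComplex (ρ i) ⊓ M ≤ M))).Homotopic
      (ContinuousMap.const _ (p i))) :
    Nonempty (K.Realization ≃ₕ WedgeSpheres (d + 1) fun j => p (Sum.inr j)) := by
  have hρK : ∀ i, simplexComplex (ρ i) ≤ K := fun i t ht => mem_of_subset (hρ i) ht.2 ht.1
  have hcompact : ∀ i, CompactSpace (simplexComplex (ρ i) ⊓ M).Realization := fun i =>
    compactSpace inf_le_left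
  have hcontr : ∀ i, ContractibleSpace (simplexComplex (ρ i)).Realization := fun i =>
    contractibleSpace_simplexComplex (nonempty_of_mem (hρ i))
  obtain ⟨E₁⟩ := nonempty_homotopyEquiv_gluing hM hρK hcover hdisj
  let ε := fun i => (Classical.choice (hB i)).toFun
  have hε : ∀ i, IsHEquiv (ε i) := fun i => IsHEquiv.of_homotopyEquiv _
  -- The left square commutes up to the null-homotopies `hp`; in the right square both composites
  -- are the index map.
  obtain ⟨E₂⟩ := DoubleCylinder.nonempty_homotopyEquiv (f := gluingLeft ρ M)
    (g := gluingRight ρ M) (f' := piecewiseConst d p) (g' := pieceIndex a b d) he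
    (IsHEquiv.sigmaMap hε)
    (isHEquiv_sigma_index (X := fun i => (simplexComplex (ρ i)).Realization))
    (Homotopic.of_sigma hp) (Homotopic.of_sigma fun i => Homotopic.refl _)
  obtain ⟨E₃⟩ := _root_.nonempty_homotopyEquiv_wedgeSpheres d p
  exact ⟨E₁.symm.trans (E₂.trans E₃)⟩

theorem starCluster_le [DecidableEq V] (K L : PreAbstractSimplicialComplex V) :
    K.starCluster L ≤ K := by
  intro s hs
  obtain ⟨v, -, hs⟩ := Set.mem_iUnion₂.1 hs
  exact mem_of_subset (K := K) hs.2 Finset.subset_union_left hs.1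

theorem mem_starCluster [DecidableEq V] {K L : PreAbstractSimplicialComplex V} {s t : Finset V}
    {v : V} (hs : s.Nonempty) (ht : t ∈ K) (hst : s ⊆ t) (hv : v ∈ t) (hvL : v ∈ L.vertices) :
    s ∈ K.starCluster L :=
  Set.mem_iUnion₂.2 ⟨v, hvL, hs, mem_of_subset ht
    (Finset.union_subset hst (Finset.singleton_subset_iff.2 hv)) (hs.mono Finset.subset_union_left)⟩

end PreAbstractSimplicialComplex

end

theorem lemma2p8 {V : Type*} [DecidableEq V] (K L : PreAbstractSimplicialComplex V)
    (hLK : L ≤ K)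
    (hK : ∀ s ∈ K, ∃ t, K.IsFacet t ∧ s ⊆ t)
    (hSC : Nonempty ((K.starCluster L).Realization ≃ₕ L.Realization))
    (a b d : ℕ) (σ : Fin a → Finset V) (τ : Fin b → Finset V)
    (hfacets : ∀ s : Finset V,
      (K.IsFacet s ∧ ∀ v ∈ s, v ∉ L.vertices) ↔ ((∃ i, σ i = s) ∨ ∃ j, τ j = s))
    (hσ : ∀ i, ContractibleSpace
      (PreAbstractSimplicialComplex.simplexComplex (σ i) ⊓ K.starCluster L).Realization)
    (hτ : ∀ j,
      Nonempty ((PreAbstractSimplicialComplex.simplexComplex (τ j) ⊓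
        K.starCluster L).Realization ≃ₕ UnitSphere d) ∧
      (PreAbstractSimplicialComplex.Realization.inclusion
        (inf_le_right : PreAbstractSimplicialComplex.simplexComplex (τ j) ⊓ K.starCluster L ≤
          K.starCluster L)).Nullhomotopic)
    (hσσ : ∀ i j, i ≠ j → PreAbstractSimplicialComplex.simplexComplex (σ i) ⊓
      PreAbstractSimplicialComplex.simplexComplex (σ j) ≤ K.starCluster L)
    (hττ : ∀ i j, i ≠ j → PreAbstractSimplicialComplex.simplexComplex (τ i) ⊓
      PreAbstractSimplicialComplex.simplexComplex (τ j) ≤ K.starCluster L)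
    (hστ : ∀ i j, PreAbstractSimplicialComplex.simplexComplex (σ i) ⊓
      PreAbstractSimplicialComplex.simplexComplex (τ j) ≤ K.starCluster L) :
    (∃ p : Fin b → L.Realization, Nonempty (K.Realization ≃ₕ WedgeSpheres (d + 1) p)) ∧
    (ConnectedSpace L.Realization → ∀ x : L.Realization,
      Nonempty (K.Realization ≃ₕ WedgeSpheres (d + 1) (fun _ : Fin b => x))) := by
  classical
  obtain ⟨e⟩ := hSC
  let ρ : Fin a ⊕ Fin b → Finset V := Sum.elim σ τ
  have hfacet : ∀ i, K.IsFacet (ρ i) := by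
    rintro (i | j)
    · exact ((hfacets (σ i)).2 (Or.inl ⟨i, rfl⟩)).1
    · exact ((hfacets (τ j)).2 (Or.inr ⟨j, rfl⟩)).1
  have hcover : ∀ s ∈ K, s ∈ K.starCluster L ∨ ∃ i, s ⊆ ρ i := by
    intro s hs
    obtain ⟨t, ht, hst⟩ := hK s hs
    by_cases hv : ∀ v ∈ t, v ∉ L.vertices
    · obtain ⟨i, rfl⟩ | ⟨j, rfl⟩ := (hfacets t).1 ⟨ht, hv⟩
      exacts [Or.inr ⟨Sum.inl i, hst⟩, Or.inr ⟨Sum.inr j, hst⟩]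
    · push Not at hv
      obtain ⟨v, hvt, hvL⟩ := hv
      exact Or.inl (PreAbstractSimplicialComplex.mem_starCluster
        (PreAbstractSimplicialComplex.nonempty_of_mem hs) ht.1 hst hvt hvL)
  have hdisj : ∀ i i', i ≠ i' → PreAbstractSimplicialComplex.simplexComplex (ρ i) ⊓
      PreAbstractSimplicialComplex.simplexComplex (ρ i') ≤ K.starCluster L := by
    rintro (i | j) (i' | j') h
    · exact hσσ i i' fun h' => h (congrArg _ h')
    · exact hστ i j'
    · rw [inf_comm]
      exact hστ i' j
    · exact hττ j j' fun h' => h (congrArg _ h')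
  have hB : ∀ i, Nonempty ((PreAbstractSimplicialComplex.simplexComplex (ρ i) ⊓
      K.starCluster L).Realization ≃ₕ pointsAndSpheres a b d i) := by
    rintro (i | j)
    · have : ContractibleSpace (PreAbstractSimplicialComplex.simplexComplex (ρ (Sum.inl i)) ⊓
        K.starCluster L).Realization := hσ i
      exact ContractibleSpace.hequiv _ PUnit
    · exact (hτ j).1
  have hnull : ∀ i, ((e.toFun).comp (PreAbstractSimplicialComplex.Realization.inclusion
      (inf_le_right : PreAbstractSimplicialComplex.simplexComplex (ρ i) ⊓ K.starCluster L ≤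
        K.starCluster L))).Nullhomotopic := by
    rintro (i | j)
    · have : ContractibleSpace (PreAbstractSimplicialComplex.simplexComplex (ρ (Sum.inl i)) ⊓
        K.starCluster L).Realization := hσ i
      exact (id_nullhomotopic (PreAbstractSimplicialComplex.simplexComplex (ρ (Sum.inl i)) ⊓
        K.starCluster L).Realization).comp_right (e.toFun.comp
          (PreAbstractSimplicialComplex.Realization.inclusion inf_le_right))
    · exact (hτ j).2.comp_right _
  choose p hp using hnull
  -- The choice of constants stays free, so that a path in `L` can replace them all by `x` in the
  -- connected case.
  have hmain := fun p hp => PreAbstractSimplicialComplex.nonempty_homotopyEquiv_wedgeSpheres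
    (d := d) ρ (PreAbstractSimplicialComplex.starCluster_le K L) (fun i => (hfacet i).1) hcover
    hdisj hB (IsHEquiv.of_homotopyEquiv e) p hp
  refine ⟨⟨fun j => p (Sum.inr j), hmain p hp⟩, fun hL x => ?_⟩
  refine hmain (fun _ => x) fun i => (hp i).trans ?_
  obtain ⟨γ⟩ := PreAbstractSimplicialComplex.Realization.joined_of_connectedSpace (p i) x
  exact ⟨⟨γ.toContinuousMap.comp ContinuousMap.fst, fun _ => γ.source, fun _ => γ.target⟩⟩
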